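/- **Setting.** Let $K$ be a complete non-archimedean valued field of characteristic $0$ with non-trivial valuation $|\cdot|$ (with values in $\mathbb{R}_{\ge 0}$), and let $\partial$ be a non-zero derivation of $K$ which is bounded, i.e. has finite operator norm. Let $p(K)$ be the characteristic of the residue field of $K$; put $\omega(K)=|p(K)|^{1/(p(K)-1)}$ if $p(K)>0$ and $\omega(K)=1$ if $p(K)=0$. The spectral norm of an additive operator $F$ on a normed space is $|F|_{sp}=\inf_{i>0}|F^i|^{1/i}$, where $|\cdot|$ is the operator norm. Put $r(K,\partial)=\omega(K)/|\partial|_{sp,K}\in(0,\infty)$. *Twisted polynomials.* For a commutative ring $R$ with a derivation $d$, let $R\langle T\rangle$ be the ring of twisted polynomials $\sum_i q_iT^i$, with multiplication determined by $Tq=qT+d(q)$ for $q\in R$, and let $L(R,d)$ be the left $R\langle T\rangle$-module with underlying group $R$, on which $R$ acts by multiplication and $T$ acts by $d$. For a ring homomorphism $f$, write $f_*$ for restriction of scalars of left modules and $f^*$ for its left adjoint, extension of scalars. Let $M$ be a left $K\langle T\rangle$-module which is finite dimensional over $K$; $\dim$ always denotes the dimension over $K$. *The modules $L_0$, $L_r$.*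 Write a power series $\sum_i a_iX^i$ as $(a_i)$. Let $\partial_X$ be the derivation $(a_i)\mapsto((i+1)a_{i+1})$ of $K[[X]]$, put $L_0=L(K[[X]],\partial_X)$, and let $f_0:K\langle T\rangle\to K[[X]]\langle T\rangle$ be induced ($T\mapsto T$) by $g_0:K\to K[[X]]$, $c\mapsto(\partial^i(c)/i!)$. For $r\in(0,r(K,\partial)]$ let $K\{X/r\}\subset K[[X]]$ be the ring of those $(a_i)$ with $\sup_i|a_i|s^i<\infty$ for every $0<s<r$. It is stable under $\partial_X$ and contains $g_0(K)$; let $f_r:K\langle T\rangle\to K\{X/r\}\langle T\rangle$ be the homomorphism induced by $g_0$, and put $L_r=L(K\{X/r\},\partial_X)$. Besides their given $K\langle T\rangle$-structure, $f_{0*}L_0$ and its submodule $f_{r*}L_r$ have a second left $K\langle T\rangle$-structure commuting with it: $c\in K$ acts by $(a_i)\mapsto(ca_i)$ and $T$ acts by $(a_i)\mapsto(\partial(a_i)-(i+1)a_{i+1})$. Through it, $\mathrm{Hom}(M,f_{r*}L_r)\subset DM:=\mathrm{Hom}(M,f_{0*}L_0)$ (homomorphisms of left $K\langle T\rangle$-modules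 for the given structures) are left $K\langle T\rangle$-modules. Let $c_M:M\to DDM$ be the canonical morphism, $c_M(x)(s)=\bigl(((\tfrac{1}{i!}T^is)(x))_0\bigr)_i$ for $x\in M$, $s\in DM$, where $(\cdot)_0$ is the coefficient of $X^0$, and put $$F_{(0,r)}M=\{x\in M:\ c_M(x)(s)=0\ \text{for all } s\in\mathrm{Hom}(M,f_{r*}L_r)\}.$$ *The function $m(M)$.* If $M$ is irreducible, let $|T|_{sp}$ be the spectral norm of $x\mapsto Tx$ on $M$ for an ultrametric norm on the $K$-vector space $M$, and for $t\in(0,r(K,\partial)]$ put $m(M)(t)=\dim M$ if $t=\omega(K)/|T|_{sp}$ and $m(M)(t)=0$ otherwise. In general, $m(M)$ is the sum of the functions $m(M_j)$ over the Jordan–Hölder factors $M_j$ of $M$ (with multiplicity). Put $\mathrm{supp}\,m(M)=\{t\in(0,r(K,\partial)]: m(M)(t)\ne0\}$. *Matrices.* For a $K$-basis $e_1,\dots,e_m$ of $M$ and $k\in\mathbb{N}$ let $G_k$ be the matrix of the multiplication by $T^k$, $T^ke_i=\sum_j(G_k)_{ij}e_j$, and let $|G_k|$ be the maximum of the absolute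 values of its entries. **Proposition.** Let $r\in(0,r(K,\partial)]$, let $M$ be as above, and let $e_1,\dots,e_m$ be any $K$-basis of $M$. The following are equivalent. 1. $\dim\mathrm{Hom}(M,f_{r*}L_r)=\dim M$. 2. There is an isomorphism $f_r^*M\cong L_r^{\dim M}$ of left $K\{X/r\}\langle T\rangle$-modules. 3. $\mathrm{supp}\,m(M)\subset[r,r(K,\partial)]$. 4. The morphism $\mathrm{Hom}(M,f_{r*}L_r)\to\mathrm{Hom}(M,f_{0*}L_0)=DM$ of left $K\langle T\rangle$-modules induced by the inclusion $f_{r*}L_r\subset f_{0*}L_0$ is an isomorphism. 5. $\omega(K)/\limsup_{i\to\infty}|G_i|^{1/i}\ge r$, where $\omega(K)/0$ is read as $+\infty$. 6. $F_{(0,r)}M=0$. In particular, whether condition 5 holds does not depend on the basis. -/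

import Mathlib

open scoped NNReal ENNReal TensorProduct

noncomputable section

namespace DiffMod

/-- A derivation of a commutative ring `R`: an additive map `d : R → R` with
`d(a b) = d(a) b + a d(b)`. -/
structure Der (R : Type*) [CommRing R] extends R →+ R where
  leibniz' : ∀ a b : R, toFun (a * b) = toFun a * b + a * toFun b

namespace Der

variable {R : Type*} [CommRing R]

instance : FunLike (Der R) R R where
  coe d := d.toAddMonoidHom
  coe_injective d e h := by
    cases d; cases e
    congr
    exact DFunLike.coe_injective h

instance : AddMonoidHomClass (Der R) R R where
  map_add d := d.toAddMonoidHom.map_add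
  map_zero d := d.toAddMonoidHom.map_zero

theorem leibniz (d : Der R) (a b : R) : d (a * b) = d a * b + a * d b := d.leibniz' a b

@[simp]
theorem map_one_eq_zero (d : Der R) : d 1 = 0 := by
  have h := d.leibniz 1 1
  rw [mul_one, mul_one, one_mul] at h
  exact left_eq_add.mp h

theorem map_natCast_eq_zero (d : Der R) (n : ℕ) : d (n : R) = 0 := by
  rw [← nsmul_one, map_nsmul, map_one_eq_zero, smul_zero]

end Der

/-! ### Twisted polynomials -/

section Twisted

variable {R : Type*} [CommRing R]

/-- The ring `R⟨T⟩` of twisted polynomials over the differential ring `(R, d)`.  The underlying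
abelian group is the group of finitely supported sequences `(qᵢ)`, written `∑ qᵢ Tⁱ`; the product
is determined by `T * q = q * T + d q` for `q ∈ R`. -/
def TwistedPoly (_d : Der R) : Type _ := ℕ →₀ R

instance (d : Der R) : AddCommGroup (TwistedPoly d) :=
  inferInstanceAs (AddCommGroup (ℕ →₀ R))

namespace TwistedPoly

/-- The monomial `a Tⁱ`. -/
def monomial (d : Der R) (i : ℕ) : R →+ TwistedPoly d := Finsupp.singleAddHom i

theorem induct {d : Der R} {P : TwistedPoly d → Prop} (h0 : P 0)
    (hadd : ∀ x y, P x → P y → P (x + y)) (hm : ∀ i a, P (monomial d i a)) (p : TwistedPoly d) :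
    P p :=
  Finsupp.induction_linear p h0 (fun x y => hadd x y) hm

/-- Given a ring homomorphism `μ : R → U` and `u ∈ U`, the additive map `∑ qᵢ Tⁱ ↦ ∑ μ(qᵢ) uⁱ`. -/
def evalAux (d : Der R) {U : Type*} [Ring U] (μ : R →+* U) (u : U) :
    TwistedPoly d →+ U :=
  Finsupp.liftAddHom fun i => (AddMonoidHom.mulRight (u ^ i)).comp μ.toAddMonoidHom

theorem evalAux_monomial (d : Der R) {U : Type*} [Ring U] (μ : R →+* U) (u : U)
    (i : ℕ) (a : R) : evalAux d μ u (monomial d i a) = μ a * u ^ i :=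
  Finsupp.liftAddHom_apply_single _ i a

/-- Left multiplication by `a ∈ R`: `∑ qᵢ Tⁱ ↦ ∑ a qᵢ Tⁱ`. -/
def smulEnd (d : Der R) : R →+* AddMonoid.End (TwistedPoly d) :=
  Module.toAddMonoidEnd R (ℕ →₀ R)

/-- Left multiplication by `T`: `∑ qᵢ Tⁱ ↦ ∑ d(qᵢ) Tⁱ + ∑ qᵢ Tⁱ⁺¹`. -/
def tEnd (d : Der R) : AddMonoid.End (TwistedPoly d) :=
  Finsupp.liftAddHom fun i =>
    (monomial d i).comp d.toAddMonoidHom + monomial d (i + 1)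

theorem smulEnd_monomial (d : Der R) (a b : R) (i : ℕ) :
    smulEnd d a (monomial d i b) = monomial d i (a * b) :=
  Finsupp.smul_single a i b

theorem tEnd_monomial (d : Der R) (b : R) (i : ℕ) :
    tEnd d (monomial d i b) = monomial d i (d b) + monomial d (i + 1) b :=
  Finsupp.liftAddHom_apply_single _ i b

theorem end_mul_apply {G : Type*} [AddCommGroup G] (f g : AddMonoid.End G) (x : G) :
    (f * g) x = f (g x) := rfl

theorem end_add_apply {G : Type*} [AddCommGroup G] (f g : AddMonoid.End G) (x : G) :
    (f + g) x = f x + g x := rfl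

theorem end_one_apply {G : Type*} [AddCommGroup G] (x : G) :
    (1 : AddMonoid.End G) x = x := rfl

theorem end_ext {G : Type*} [AddCommGroup G] {f g : AddMonoid.End G} (h : ∀ x, f x = g x) :
    f = g := AddMonoidHom.ext h

theorem tEnd_mul_smulEnd (d : Der R) (r : R) :
    tEnd d * smulEnd d r = smulEnd d r * tEnd d + smulEnd d (d r) := by
  refine end_ext fun q => ?_
  induction q using induct with
  | h0 =>
    exact (map_zero (tEnd d * smulEnd d r)).trans
      (map_zero (smulEnd d r * tEnd d + smulEnd d (d r))).symm
  | hadd x y hx hy =>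
    exact (map_add (tEnd d * smulEnd d r) x y).trans ((congrArg₂ (· + ·) hx hy).trans
      (map_add (smulEnd d r * tEnd d + smulEnd d (d r)) x y).symm)
  | hm i a =>
    rw [end_add_apply, end_mul_apply, end_mul_apply]
    simp only [smulEnd_monomial, tEnd_monomial, map_add, Der.leibniz]
    abel

/-- `∑ pᵢ Tⁱ` acting on `R⟨T⟩` by left multiplication. -/
def mulLeft (d : Der R) : TwistedPoly d →+ AddMonoid.End (TwistedPoly d) :=
  evalAux d (smulEnd d) (tEnd d)

theorem tEnd_pow_monomial (d : Der R) (i : ℕ) :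
    (tEnd d ^ i) (monomial d 0 1) = monomial d i 1 := by
  induction i with
  | zero => rw [pow_zero]; rfl
  | succ i ih => rw [pow_succ', end_mul_apply, ih, tEnd_monomial]; simp

theorem mulLeft_monomial (d : Der R) (i : ℕ) (a : R) (q : TwistedPoly d) :
    mulLeft d (monomial d i a) q = smulEnd d a ((tEnd d ^ i) q) := by
  rw [mulLeft, evalAux_monomial, end_mul_apply]

theorem mulLeft_add (d : Der R) (p p' q : TwistedPoly d) :
    mulLeft d (p + p') q = mulLeft d p q + mulLeft d p' q := by
  rw [map_add, end_add_apply]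

theorem mulLeft_zero (d : Der R) (q : TwistedPoly d) : mulLeft d 0 q = 0 := by
  rw [map_zero]; rfl

theorem evalAux_mulLeft (d : Der R) {U : Type*} [Ring U] (μ : R →+* U) (u : U)
    (h : ∀ r, u * μ r = μ r * u + μ (d r)) (p q : TwistedPoly d) :
    evalAux d μ u (mulLeft d p q) = evalAux d μ u p * evalAux d μ u q := by
  have hs : ∀ (a : R) (q : TwistedPoly d),
      evalAux d μ u (smulEnd d a q) = μ a * evalAux d μ u q := by
    intro a q
    induction q using induct with
    | h0 => rw [map_zero, map_zero, mul_zero]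
    | hadd x y hx hy => rw [map_add, map_add, map_add, mul_add, hx, hy]
    | hm i b =>
      rw [smulEnd_monomial, evalAux_monomial, evalAux_monomial, map_mul, mul_assoc]
  have ht : ∀ q : TwistedPoly d, evalAux d μ u (tEnd d q) = u * evalAux d μ u q := by
    intro q
    induction q using induct with
    | h0 => rw [map_zero, map_zero, mul_zero]
    | hadd x y hx hy => rw [map_add, map_add, map_add, mul_add, hx, hy]
    | hm i b =>
      rw [tEnd_monomial, map_add, evalAux_monomial, evalAux_monomial, evalAux_monomial,
        ← mul_assoc, h, pow_succ', add_mul, mul_assoc]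
      abel
  have htp : ∀ (i : ℕ) (q : TwistedPoly d),
      evalAux d μ u ((tEnd d ^ i) q) = u ^ i * evalAux d μ u q := by
    intro i q
    induction i with
    | zero => rw [pow_zero, pow_zero, one_mul, end_one_apply]
    | succ i ih => rw [pow_succ', end_mul_apply, ht, ih, pow_succ', mul_assoc]
  induction p using induct with
  | h0 => rw [mulLeft_zero, map_zero, zero_mul]
  | hadd x y hx hy => rw [mulLeft_add, map_add, map_add, hx, hy, add_mul]
  | hm i b => rw [mulLeft_monomial, hs, htp, evalAux_monomial, mul_assoc]

instance (d : Der R) : Ring (TwistedPoly d) :=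
  { (inferInstance : AddCommGroup (TwistedPoly d)) with
    mul := fun p q => mulLeft d p q
    one := monomial d 0 1
    left_distrib := fun p q r => map_add (mulLeft d p) q r
    right_distrib := fun p q r => by
      change mulLeft d (p + q) r = mulLeft d p r + mulLeft d q r
      exact mulLeft_add d p q r
    zero_mul := fun p => by
      change mulLeft d 0 p = 0
      exact mulLeft_zero d p
    mul_zero := fun p => map_zero (mulLeft d p)
    one_mul := fun p => by
      change mulLeft d (monomial d 0 1) p = p
      rw [mulLeft_monomial, pow_zero, map_one]; rfl
    mul_one := fun p => by
      change mulLeft d p (monomial d 0 1) = p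
      induction p using induct with
      | h0 => exact mulLeft_zero d _
      | hadd x y hx hy => rw [mulLeft_add, hx, hy]
      | hm i b => rw [mulLeft_monomial, tEnd_pow_monomial, smulEnd_monomial, mul_one]
    mul_assoc := fun p q r =>
      DFunLike.congr_fun (evalAux_mulLeft d (smulEnd d) (tEnd d) (tEnd_mul_smulEnd d) p q) r }

theorem mul_def {d : Der R} (p q : TwistedPoly d) : p * q = mulLeft d p q := rfl

theorem one_def {d : Der R} : (1 : TwistedPoly d) = monomial d 0 1 := rfl

/-- The inclusion `i : R → R⟨T⟩`. -/
def C (d : Der R) : R →+* TwistedPoly d where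
  toFun := monomial d 0
  map_zero' := map_zero _
  map_one' := rfl
  map_add' := map_add _
  map_mul' a b := by simp [mul_def, mulLeft_monomial, smulEnd_monomial]

/-- The variable `T`. -/
def T (d : Der R) : TwistedPoly d := monomial d 1 1

theorem T_mul_C (d : Der R) (r : R) : T d * C d r = C d r * T d + C d (d r) := by
  change mulLeft d (monomial d 1 1) (monomial d 0 r) =
    mulLeft d (monomial d 0 r) (monomial d 1 1) + monomial d 0 (d r)
  simp [mulLeft_monomial, smulEnd_monomial, tEnd_monomial, add_comm]

theorem monomial_eq (d : Der R) (i : ℕ) (a : R) :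
    monomial d i a = C d a * T d ^ i := by
  have hT : ∀ q : TwistedPoly d, T d * q = tEnd d q := fun q => by
    change mulLeft d (monomial d 1 1) q = _
    simp [mulLeft_monomial]
  have hp : ∀ i : ℕ, T d ^ i = monomial d i 1 := by
    intro i
    induction i with
    | zero => rfl
    | succ i ih => rw [pow_succ', ih, hT, tEnd_monomial]; simp
  rw [hp]
  change _ = mulLeft d (monomial d 0 a) (monomial d i 1)
  simp [mulLeft_monomial, smulEnd_monomial]

/-- The universal property of `R⟨T⟩`: the ring homomorphism `∑ qᵢ Tⁱ ↦ ∑ μ(qᵢ) uⁱ`, for a ring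
homomorphism `μ : R → U` and an element `u` with `u μ(r) = μ(r) u + μ(d r)`. -/
def lift (d : Der R) {U : Type*} [Ring U] (μ : R →+* U) (u : U)
    (h : ∀ r, u * μ r = μ r * u + μ (d r)) : TwistedPoly d →+* U :=
  { evalAux d μ u with
    map_one' := by
      change evalAux d μ u (monomial d 0 1) = 1
      simp [evalAux_monomial]
    map_mul' := evalAux_mulLeft d μ u h }

theorem lift_monomial (d : Der R) {U : Type*} [Ring U] (μ : R →+* U) (u : U)
    (h : ∀ r, u * μ r = μ r * u + μ (d r)) (i : ℕ) (a : R) :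
    lift d μ u h (monomial d i a) = μ a * u ^ i :=
  evalAux_monomial d μ u i a

theorem lift_C (d : Der R) {U : Type*} [Ring U] (μ : R →+* U) (u : U)
    (h : ∀ r, u * μ r = μ r * u + μ (d r)) (a : R) : lift d μ u h (C d a) = μ a := by
  change lift d μ u h (monomial d 0 a) = _
  simp [lift_monomial]

theorem lift_T (d : Der R) {U : Type*} [Ring U] (μ : R →+* U) (u : U)
    (h : ∀ r, u * μ r = μ r * u + μ (d r)) : lift d μ u h (T d) = u := by
  simp [T, lift_monomial]

/-- The ring homomorphism `R⟨T⟩ → S⟨T⟩`, `∑ qᵢ Tⁱ ↦ ∑ g(qᵢ) Tⁱ`, associated with a ring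
homomorphism `g : R → S` that commutes with the derivations. -/
def map {S : Type*} [CommRing S] (d : Der R) (e : Der S) (g : R →+* S)
    (h : ∀ r, g (d r) = e (g r)) : TwistedPoly d →+* TwistedPoly e :=
  lift d ((C e).comp g) (T e) fun r => by simp [T_mul_C, h]

/-- An additive map between left `R⟨T⟩`-modules that commutes with `R` and with `T` is linear. -/
def linearMapOfAdd {d : Der R} {N N' : Type*} [AddCommGroup N] [AddCommGroup N']
    [Module (TwistedPoly d) N] [Module (TwistedPoly d) N'] (F : N →+ N')
    (hC : ∀ c x, F (C d c • x) = C d c • F x) (hT : ∀ x, F (T d • x) = T d • F x) :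
    N →ₗ[TwistedPoly d] N' :=
  { F with
    map_smul' := fun p x => by
      have hTp : ∀ (i : ℕ) (x : N), F (T d ^ i • x) = T d ^ i • F x := by
        intro i
        induction i with
        | zero => simp
        | succ i ih => intro x; rw [pow_succ', mul_smul, hT, ih, mul_smul]
      change F (p • x) = p • F x
      induction p using induct with
      | h0 => rw [zero_smul, zero_smul, map_zero]
      | hadd p q hp hq => rw [add_smul, add_smul, map_add, hp, hq]
      | hm i b => rw [monomial_eq, mul_smul, mul_smul, hC, hTp] }

end TwistedPoly

end Twisted

/-! ### Change of rings -/

section ChangeOfRings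

variable {R S : Type*} [Ring R] [Ring S]

/-- The push-out `f_* N` of a left `S`-module `N` along `f : R → S`: the abelian group `N` with
`a • x = f a • x`. -/
def Restrict (_f : R →+* S) (N : Type*) : Type _ := N

instance (f : R →+* S) (N : Type*) [AddCommGroup N] : AddCommGroup (Restrict f N) :=
  inferInstanceAs (AddCommGroup N)

instance (f : R →+* S) (N : Type*) [AddCommGroup N] [Module S N] : Module R (Restrict f N) :=
  Module.compHom N f

/-- The identity map `N → f_* N`. -/
def toRestrict (f : R →+* S) (N : Type*) [AddCommGroup N] : N ≃+ Restrict f N := AddEquiv.refl N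

theorem smul_toRestrict (f : R →+* S) (N : Type*) [AddCommGroup N] [Module S N] (a : R) (x : N) :
    a • toRestrict f N x = toRestrict f N (f a • x) := rfl

/-- An `S`-linear map, regarded as an `R`-linear map of push-outs. -/
def restrictMap (f : R →+* S) {N N' : Type*} [AddCommGroup N] [Module S N] [AddCommGroup N']
    [Module S N'] (α : N →ₗ[S] N') : Restrict f N →ₗ[R] Restrict f N' where
  toFun := α
  map_add' := α.map_add
  map_smul' a x := α.map_smul (f a) x

/-- The pull-back `f^* M = S ⊗_R M` of a left `R`-module along a homomorphism `f : R → S` of (not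
necessarily commutative) rings: the quotient of `S ⊗_ℤ M` by the elements
`(s f(a)) ⊗ m - s ⊗ (a m)`, with `S` acting on the left factor. -/
def Extend (f : R →+* S) (M : Type*) [AddCommGroup M] [Module R M] : Type _ :=
  (S ⊗[ℤ] M) ⧸ Submodule.span S
    {x : S ⊗[ℤ] M | ∃ (s : S) (a : R) (m : M), x = (s * f a) ⊗ₜ[ℤ] m - s ⊗ₜ[ℤ] (a • m)}

instance (f : R →+* S) (M : Type*) [AddCommGroup M] [Module R M] : AddCommGroup (Extend f M) := by
  unfold Extend; infer_instance

instance (f : R →+* S) (M : Type*) [AddCommGroup M] [Module R M] : Module S (Extend f M) := by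
  unfold Extend; infer_instance

/-- For a left `A`-object `(X, ρ)` in the category of left `R`-modules and a left `R`-module `M`,
the left `A`-module `Hom_R(M, X)`, where `(a • s)(m) = ρ(a)(s(m))`. -/
def HomObj {A : Type*} [Ring A] (M : Type*) [AddCommGroup M] [Module R M] {X : Type*}
    [AddCommGroup X] [Module R X] (_ρ : A →+* Module.End R X) : Type _ := M →ₗ[R] X

section

variable {A : Type*} [Ring A] (M : Type*) [AddCommGroup M] [Module R M] {X : Type*}
    [AddCommGroup X] [Module R X] (ρ : A →+* Module.End R X)

instance : AddCommGroup (HomObj M ρ) := inferInstanceAs (AddCommGroup (M →ₗ[R] X))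

instance : Module A (HomObj M ρ) := Module.compHom (M →ₗ[R] X) ρ

variable {M ρ}

/-- An element of `Hom_R(M, X)` as a linear map. -/
def HomObj.toHom (s : HomObj M ρ) : M →ₗ[R] X := s

theorem HomObj.smul_toHom (a : A) (s : HomObj M ρ) (x : M) :
    (a • s).toHom x = ρ a (s.toHom x) := rfl

theorem HomObj.add_toHom (s t : HomObj M ρ) (x : M) :
    (s + t).toHom x = s.toHom x + t.toHom x := rfl

end

end ChangeOfRings

/-- The left `R⟨T⟩`-module `L(R, d)`: the abelian group `R`, on which `R` acts by multiplication
and `T` acts by `d`. -/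
def Triv {R : Type*} [CommRing R] (_d : Der R) : Type _ := R

section Triv

variable {R : Type*} [CommRing R] (d : Der R)

instance : AddCommGroup (Triv d) := inferInstanceAs (AddCommGroup R)

/-- The identity map `R → L(R, d)`. -/
def toTriv : R ≃+ Triv d := AddEquiv.refl R

/-- Multiplication by an element of `R` on `L(R, d)`. -/
def Triv.mulEnd : R →+* AddMonoid.End (Triv d) := Module.toAddMonoidEnd R R

/-- The derivation `d` on `L(R, d)`. -/
def Triv.derivEnd : AddMonoid.End (Triv d) := d.toAddMonoidHom

/-- The action of `R⟨T⟩` on `L(R, d)`. -/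
def Triv.act : TwistedPoly d →+* AddMonoid.End (Triv d) :=
  TwistedPoly.lift d (Triv.mulEnd d) (Triv.derivEnd d) fun r => by
    refine TwistedPoly.end_ext fun (x : R) => ?_
    change d (r * x) = r * d x + d r * x
    rw [Der.leibniz, add_comm]

instance : Module (TwistedPoly d) (Triv d) := Module.compHom (Triv d) (Triv.act d)

theorem Triv.C_smul (c x : R) :
    TwistedPoly.C d c • toTriv d x = toTriv d (c * x) := by
  change Triv.act d (TwistedPoly.C d c) x = _
  rw [Triv.act, TwistedPoly.lift_C]; rfl

theorem Triv.T_smul (x : R) :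
    TwistedPoly.T d • toTriv d x = toTriv d (d x) := by
  change Triv.act d (TwistedPoly.T d) x = _
  rw [Triv.act, TwistedPoly.lift_T]; rfl

end Triv

/-! ### Invariants of the base field -/

section Field

variable (K : Type*) [NontriviallyNormedField K] [IsUltrametricDist K]

/-- `p(K)`: the characteristic of the residue field of `K`. -/
def resChar : ℕ :=
  ringChar (IsLocalRing.ResidueField (NormedField.valuation (K := K)).valuationSubring)

/-- `ω(K)`: equal to `|p|^(1/(p-1))` if `p = p(K) > 0`, and to `1` if `p(K) = 0`. -/
def omega : ℝ :=
  if resChar K = 0 then 1 else ‖(resChar K : K)‖ ^ (1 / ((resChar K : ℝ) - 1))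

/-- The operator norm `sup {|f x| / |x| ; x ≠ 0}` of a self-map `f` with respect to `N = |·|`. -/
def opNorm {X : Type*} [Zero X] (N : X → ℝ) (f : X → X) : ℝ :=
  sSup {c : ℝ | ∃ x : X, x ≠ 0 ∧ c = N (f x) / N x}

/-- The spectral norm `inf {|fⁱ|^(1/i) ; i > 0}` of a self-map `f` with respect to `N = |·|`. -/
def spNorm {X : Type*} [Zero X] (N : X → ℝ) (f : X → X) : ℝ :=
  ⨅ i : ℕ+, opNorm N (f^[(i : ℕ)]) ^ (1 / ((i : ℕ) : ℝ))

variable {K}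

/-- The derivation `d` is bounded, i.e. it has a finite operator norm. -/
def IsBdd (d : Der K) : Prop := ∃ C : ℝ, ∀ x, ‖d x‖ ≤ C * ‖x‖

/-- `r(K, d) = ω(K) / |d|_sp`. -/
def genRadius (d : Der K) : ℝ := omega K / spNorm (fun x : K => ‖x‖) d

/-! #### The Taylor coefficients `dⁿ(c)/n!` -/

theorem norm_natCast_eq_one {n : ℕ} (h : ¬ resChar K ∣ n) : ‖(n : K)‖ = 1 := by
  refine le_antisymm (IsUltrametricDist.norm_natCast_le_one K n) ?_
  by_contra hlt
  push Not at hlt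
  apply h
  have hmem : (n : (NormedField.valuation (K := K)).valuationSubring) ∈
      IsLocalRing.maximalIdeal (NormedField.valuation (K := K)).valuationSubring := by
    rw [(NormedField.valuation (K := K)).valuationSubring.valuation_lt_one_iff]
    have : (NormedField.valuation (K := K)) (n : K) < 1 := by
      rw [NormedField.valuation_apply, ← NNReal.coe_lt_coe]
      simpa using hlt
    have := (Valuation.isEquiv_valuation_valuationSubring
      (NormedField.valuation (K := K))).lt_one_iff_lt_one.mp this
    simpa using this
  have h0 : (n : IsLocalRing.ResidueField (NormedField.valuation (K := K)).valuationSubring) = 0 := by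
    rw [← IsLocalRing.residue_eq_zero_iff] at hmem
    simpa using hmem
  exact (ringChar.spec _ n).mp h0

theorem omega_nonneg : 0 ≤ omega K := by
  unfold omega
  split_ifs
  · exact zero_le_one
  · positivity

theorem resChar_eq_zero_or_prime : resChar K = 0 ∨ (resChar K).Prime :=
  (CharP.char_is_prime_or_zero
    (IsLocalRing.ResidueField (NormedField.valuation (K := K)).valuationSubring)
      (resChar K)).symm

theorem norm_resChar_le_one : ‖(resChar K : K)‖ ≤ 1 := IsUltrametricDist.norm_natCast_le_one K _

theorem norm_natCast_eq_pow [CharZero K] {n : ℕ} (hn : n ≠ 0) (hp : (resChar K).Prime) :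
    ‖(n : K)‖ = ‖(resChar K : K)‖ ^ padicValNat (resChar K) n := by
  obtain ⟨k, m, hm, rfl⟩ := Nat.exists_eq_pow_mul_and_not_dvd hn (resChar K) hp.ne_one
  have hm0 : m ≠ 0 := fun h => hm (h ▸ dvd_zero _)
  have : Fact (resChar K).Prime := ⟨hp⟩
  rw [padicValNat.mul (pow_ne_zero _ hp.ne_zero) hm0, padicValNat.prime_pow,
    padicValNat.eq_zero_of_not_dvd hm, add_zero, Nat.cast_mul, norm_mul, norm_natCast_eq_one hm,
    mul_one, Nat.cast_pow, norm_pow]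

theorem omega_pow_le_norm_factorial [CharZero K] (n : ℕ) :
    omega K ^ n ≤ ‖((n.factorial : ℕ) : K)‖ := by
  unfold omega
  split_ifs with h
  · rw [one_pow, norm_natCast_eq_one]
    rw [h, zero_dvd_iff]
    exact n.factorial_ne_zero
  · have hp : (resChar K).Prime := resChar_eq_zero_or_prime.resolve_left h
    have : Fact (resChar K).Prime := ⟨hp⟩
    have hpos : 0 < ‖(resChar K : K)‖ := norm_pos_iff.mpr (Nat.cast_ne_zero.mpr hp.ne_zero)
    have h1 : (0 : ℝ) < (resChar K : ℝ) - 1 := by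
      have : (1 : ℝ) < resChar K := by exact_mod_cast hp.one_lt
      linarith
    rw [norm_natCast_eq_pow n.factorial_ne_zero hp, ← Real.rpow_natCast, ← Real.rpow_natCast,
      ← Real.rpow_mul hpos.le]
    refine Real.rpow_le_rpow_of_exponent_ge hpos norm_resChar_le_one ?_
    rw [one_div, inv_mul_eq_div, le_div_iff₀ h1]
    have h2 : (resChar K - 1) * padicValNat (resChar K) n.factorial ≤ n := by
      rw [sub_one_mul_padicValNat_factorial]
      exact Nat.sub_le _ _
    have h3 : ((resChar K - 1 : ℕ) : ℝ) = (resChar K : ℝ) - 1 := by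
      rw [Nat.cast_sub hp.one_lt.le, Nat.cast_one]
    rw [← h3, mul_comm]
    exact_mod_cast h2

theorem opNorm_nonneg {X : Type*} [Zero X] {N : X → ℝ} (hN : ∀ x, 0 ≤ N x) (f : X → X) :
    0 ≤ opNorm N f := by
  refine Real.sSup_nonneg ?_
  rintro c ⟨x, -, rfl⟩
  exact div_nonneg (hN _) (hN _)

theorem norm_iterate_le {K : Type*} [NontriviallyNormedField K] {d : Der K} {C : ℝ} (hC : 0 ≤ C) (hb : ∀ x, ‖d x‖ ≤ C * ‖x‖)
    (n : ℕ) (x : K) : ‖d^[n] x‖ ≤ C ^ n * ‖x‖ := by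
  induction n with
  | zero => simp
  | succ n ih =>
    rw [Function.iterate_succ_apply']
    calc ‖d (d^[n] x)‖ ≤ C * ‖d^[n] x‖ := hb _
      _ ≤ C * (C ^ n * ‖x‖) := by gcongr
      _ = C ^ (n + 1) * ‖x‖ := by ring

theorem exists_norm_iterate_le {K : Type*} [NontriviallyNormedField K] {d : Der K} (hb : IsBdd d) {τ : ℝ} (hτ : 0 < τ)
    (h : spNorm (fun x : K => ‖x‖) d < τ) (c : K) :
    ∃ B : ℝ, ∀ n : ℕ, ‖d^[n] c‖ ≤ B * τ ^ n := by
  obtain ⟨C, hC⟩ := hb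
  have hC' : ∀ x, ‖d x‖ ≤ max C 0 * ‖x‖ := fun x =>
    (hC x).trans (mul_le_mul_of_nonneg_right (le_max_left _ _) (norm_nonneg _))
  obtain ⟨i, hi⟩ := exists_lt_of_ciInf_lt h
  have hi0 : 0 < (i : ℕ) := i.pos
  have hbd : BddAbove {c : ℝ | ∃ x : K, x ≠ 0 ∧ c = ‖d^[(i : ℕ)] x‖ / ‖x‖} := by
    refine ⟨max C 0 ^ (i : ℕ), ?_⟩
    rintro _ ⟨x, hx, rfl⟩
    rw [div_le_iff₀ (norm_pos_iff.mpr hx)]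
    exact norm_iterate_le (le_max_right _ _) hC' _ _
  have hstep : ∀ x, ‖d^[(i : ℕ)] x‖ ≤ τ ^ (i : ℕ) * ‖x‖ := by
    intro x
    by_cases hx : x = 0
    · subst hx
      rw [iterate_map_zero]; simp
    · rw [← div_le_iff₀ (norm_pos_iff.mpr hx)]
      refine (le_csSup hbd ⟨x, hx, rfl⟩).trans ?_
      change opNorm (fun x : K => ‖x‖) d^[(i : ℕ)] ≤ _
      have h0 := opNorm_nonneg (N := fun x : K => ‖x‖) (fun x => norm_nonneg x) d^[(i : ℕ)]
      have h1 : (opNorm (fun x : K => ‖x‖) d^[(i : ℕ)] ^ (1 / ((i : ℕ) : ℝ))) ^ (i : ℕ) =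
          opNorm (fun x : K => ‖x‖) d^[(i : ℕ)] := by
        rw [one_div, Real.rpow_inv_natCast_pow h0 hi0.ne']
      rw [← h1]
      exact pow_le_pow_left₀ (Real.rpow_nonneg h0 _) hi.le _
  have hq : ∀ q : ℕ, ∀ x, ‖d^[(i : ℕ) * q] x‖ ≤ τ ^ ((i : ℕ) * q) * ‖x‖ := by
    intro q
    induction q with
    | zero => simp
    | succ q ih =>
      intro x
      rw [Nat.mul_succ, Function.iterate_add_apply]
      calc _ ≤ τ ^ ((i : ℕ) * q) * ‖d^[(i : ℕ)] x‖ := ih _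
        _ ≤ τ ^ ((i : ℕ) * q) * (τ ^ (i : ℕ) * ‖x‖) := by gcongr; exact hstep x
        _ = _ := by rw [pow_add]; ring
  refine ⟨∑ k ∈ Finset.range i, ‖d^[k] c‖ / τ ^ k, fun n => ?_⟩
  have hn : n = (i : ℕ) * (n / i) + n % i := (Nat.div_add_mod n i).symm
  have hk : n % i ∈ Finset.range i := Finset.mem_range.mpr (Nat.mod_lt _ hi0)
  have hle : ‖d^[n % i] c‖ / τ ^ (n % i) ≤ ∑ k ∈ Finset.range i, ‖d^[k] c‖ / τ ^ k :=
    Finset.single_le_sum (f := fun k => ‖d^[k] c‖ / τ ^ k)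
      (fun k _ => div_nonneg (norm_nonneg _) (pow_nonneg hτ.le _)) hk
  calc ‖d^[n] c‖ = ‖d^[(i : ℕ) * (n / i)] (d^[n % i] c)‖ := by
        rw [← Function.iterate_add_apply, ← hn]
    _ ≤ τ ^ ((i : ℕ) * (n / i)) * ‖d^[n % i] c‖ := hq _ _
    _ = ‖d^[n % i] c‖ / τ ^ (n % i) * τ ^ n := by
        conv_rhs => rw [show τ ^ n = τ ^ ((i : ℕ) * (n / i)) * τ ^ (n % i) by
          rw [← pow_add, ← hn]]
        field_simp
    _ ≤ _ := by gcongr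

theorem taylor_bdd [CharZero K] {d : Der K} (hb : IsBdd d) {r : ℝ}
    (hr : r ≤ genRadius d) {s : ℝ≥0} (hs0 : 0 < s) (hs : (s : ℝ) < r) (c : K) :
    BddAbove (Set.range fun n : ℕ => ‖((n.factorial : ℕ) : K)⁻¹ * d^[n] c‖ * (s : ℝ) ^ n) := by
  have hs0' : (0 : ℝ) < s := hs0
  have hpos : 0 < genRadius d := hs0'.trans (hs.trans_le hr)
  have hsp0 : 0 ≤ spNorm (fun x : K => ‖x‖) d :=
    Real.iInf_nonneg fun i => Real.rpow_nonneg (opNorm_nonneg (fun x => norm_nonneg x) _) _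
  have hsp : 0 < spNorm (fun x : K => ‖x‖) d := by
    refine hsp0.lt_of_ne fun h => ?_
    rw [genRadius, ← h, div_zero] at hpos
    exact lt_irrefl _ hpos
  have hω : 0 < omega K := by
    refine omega_nonneg.lt_of_ne fun h => ?_
    rw [genRadius, ← h, zero_div] at hpos
    exact lt_irrefl _ hpos
  have hlt : spNorm (fun x : K => ‖x‖) d < omega K / s := by
    rw [lt_div_iff₀ hs0', mul_comm, ← lt_div_iff₀ hsp]
    exact hs.trans_le hr
  obtain ⟨B, hB⟩ := exists_norm_iterate_le hb (div_pos hω hs0') hlt c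
  refine ⟨B, ?_⟩
  rintro _ ⟨n, rfl⟩
  have hf := omega_pow_le_norm_factorial (K := K) n
  have hf0 : 0 < ‖((n.factorial : ℕ) : K)‖ := (pow_pos hω n).trans_le hf
  have hB0 : 0 ≤ B := by
    have := (norm_nonneg _).trans (hB 0)
    simpa using this
  change ‖((n.factorial : ℕ) : K)⁻¹ * d^[n] c‖ * (s : ℝ) ^ n ≤ B
  rw [norm_mul, norm_inv, mul_assoc, inv_mul_le_iff₀ hf0]
  calc ‖d^[n] c‖ * (s : ℝ) ^ n ≤ B * (omega K / s) ^ n * (s : ℝ) ^ n := by gcongr; exact hB n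
    _ = omega K ^ n * B := by rw [div_pow]; field_simp
    _ ≤ _ := by gcongr

end Field

/-! ### Rings of power series -/

section FormalSeries

variable (K : Type*) [Field K]

/-- The derivation `∂_X` of `K[[X]]`, `(aᵢ) ↦ ((i+1) aᵢ₊₁)`. -/
def dX : Der (PowerSeries K) where
  toAddMonoidHom := (PowerSeries.derivative K : PowerSeries K →+ PowerSeries K)
  leibniz' a b := by
    change PowerSeries.derivative K (a * b) =
      PowerSeries.derivative K a * b + a * PowerSeries.derivative K b
    rw [Derivation.leibniz, smul_eq_mul, smul_eq_mul]
    ring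

variable {K}

theorem coeff_dX (a : PowerSeries K) (n : ℕ) :
    PowerSeries.coeff n (dX K a) = PowerSeries.coeff (n + 1) a * ((n : K) + 1) :=
  PowerSeries.coeff_derivative a n

/-- The additive map of `K[[X]]` that applies `d` to every coefficient. -/
def coeffDAux (d : Der K) : PowerSeries K →+ PowerSeries K where
  toFun a := PowerSeries.mk fun i => d (PowerSeries.coeff i a)
  map_zero' := by ext; simp
  map_add' a b := by ext; simp

theorem coeff_coeffDAux (d : Der K) (a : PowerSeries K) (n : ℕ) :
    PowerSeries.coeff n (coeffDAux d a) = d (PowerSeries.coeff n a) := by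
  simp [coeffDAux]

/-- The derivation of `K[[X]]` that applies `d` to every coefficient. -/
def coeffD (d : Der K) : Der (PowerSeries K) where
  toAddMonoidHom := coeffDAux d
  leibniz' a b := by
    ext n
    change PowerSeries.coeff n (coeffDAux d (a * b)) =
      PowerSeries.coeff n (coeffDAux d a * b + a * coeffDAux d b)
    simp only [coeff_coeffDAux, PowerSeries.coeff_mul, map_sum, Der.leibniz, map_add,
      Finset.sum_add_distrib]

theorem coeff_coeffD (d : Der K) (a : PowerSeries K) (n : ℕ) :
    PowerSeries.coeff n (coeffD d a) = d (PowerSeries.coeff n a) :=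
  coeff_coeffDAux d a n

variable (d : Der K)

/-- The power series `∑ dⁱ(c)/i! Xⁱ`. -/
def taylor (c : K) : PowerSeries K :=
  PowerSeries.mk fun i => ((i.factorial : ℕ) : K)⁻¹ * d^[i] c

theorem dX_taylor [CharZero K] (c : K) : dX K (taylor d c) = taylor d (d c) := by
  ext n
  rw [coeff_dX, taylor, taylor, PowerSeries.coeff_mk, PowerSeries.coeff_mk,
    Function.iterate_succ_apply, Nat.factorial_succ]
  have h1 : ((n : K) + 1) ≠ 0 := by exact_mod_cast n.succ_ne_zero
  have h2 : ((n.factorial : ℕ) : K) ≠ 0 := by exact_mod_cast n.factorial_ne_zero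
  push_cast
  field_simp

theorem coeff_zero_taylor (c : K) : PowerSeries.coeff 0 (taylor d c) = c := by
  simp [taylor]

theorem taylor_add (a b : K) : taylor d (a + b) = taylor d a + taylor d b := by
  ext n
  rw [map_add]
  simp only [taylor, PowerSeries.coeff_mk, iterate_map_add, mul_add]

theorem taylor_mul [CharZero K] (a b : K) : taylor d (a * b) = taylor d a * taylor d b := by
  suffices h : ∀ n : ℕ, ∀ a b : K,
      PowerSeries.coeff n (taylor d (a * b)) = PowerSeries.coeff n (taylor d a * taylor d b) from
    PowerSeries.ext fun n => h n a b
  intro n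
  induction n with
  | zero =>
    intro a b
    rw [PowerSeries.coeff_mul]
    simp [taylor]
  | succ n ih =>
    intro a b
    have h1 : ((n : K) + 1) ≠ 0 := by exact_mod_cast n.succ_ne_zero
    refine mul_right_cancel₀ h1 ?_
    rw [← coeff_dX, ← coeff_dX, dX_taylor, Der.leibniz, Der.leibniz, taylor_add,
      map_add, map_add, dX_taylor, dX_taylor]
    simp only [ih]

/-- The ring homomorphism `g₀ : K → K[[X]]`, `c ↦ ∑ dⁱ(c)/i! Xⁱ`. -/
def g0 [CharZero K] : K →+* PowerSeries K where
  toFun := taylor d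
  map_zero' := by ext; simp [taylor]
  map_one' := by
    ext n
    rcases n with _ | n
    · simp [taylor]
    · simp [taylor, PowerSeries.coeff_one, iterate_map_zero]
  map_add' := taylor_add d
  map_mul' := taylor_mul d

theorem g0_d [CharZero K] (c : K) : g0 d (d c) = dX K (g0 d c) := (dX_taylor d c).symm

theorem coeffD_g0 [CharZero K] (c : K) : coeffD d (g0 d c) = dX K (g0 d c) := by
  rw [← g0_d]
  ext n
  rw [coeff_coeffD]
  change d (PowerSeries.coeff n (taylor d c)) = PowerSeries.coeff n (taylor d (d c))
  have hf : ((n.factorial : ℕ) : K) ≠ 0 := by exact_mod_cast n.factorial_ne_zero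
  refine mul_left_cancel₀ hf ?_
  have h1 : ∀ x : K, ((n.factorial : ℕ) : K) * d x = d (((n.factorial : ℕ) : K) * x) := by
    intro x
    rw [Der.leibniz, Der.map_natCast_eq_zero, zero_mul, zero_add]
  rw [h1, taylor, taylor, PowerSeries.coeff_mk, PowerSeries.coeff_mk, mul_inv_cancel_left₀ hf,
    mul_inv_cancel_left₀ hf, ← Function.iterate_succ_apply' d n c, Function.iterate_succ_apply]

end FormalSeries

/-- A derivation of a ring restricted to a stable subring. -/
def restrictDeriv {A : Type*} [CommRing A] (D : Der A) (B : Subring A)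
    (h : ∀ a ∈ B, D a ∈ B) : Der B where
  toFun a := ⟨D a, h a a.2⟩
  map_zero' := Subtype.ext (map_zero D)
  map_add' a b := Subtype.ext (map_add D (a : A) b)
  leibniz' a b := Subtype.ext (D.leibniz (a : A) b)

theorem coe_restrictDeriv {A : Type*} [CommRing A] (D : Der A) (B : Subring A)
    (h : ∀ a ∈ B, D a ∈ B) (a : B) : (restrictDeriv D B h a : A) = D a := rfl

section Series

variable (K : Type*) [NontriviallyNormedField K] [IsUltrametricDist K]

/-- The ring `K[[X/s]]₀` of the power series `∑ aᵢ Xⁱ` with `sup |aᵢ| sⁱ < ∞`. -/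
def bddSeries (s : ℝ≥0) : Subring (PowerSeries K) where
  carrier := {a | BddAbove (Set.range fun i : ℕ => ‖PowerSeries.coeff i a‖ * (s : ℝ) ^ i)}
  zero_mem' := ⟨0, by rintro _ ⟨i, rfl⟩; simp⟩
  one_mem' := by
    refine ⟨1, ?_⟩
    rintro _ ⟨i, rfl⟩
    rcases eq_or_ne i 0 with rfl | hi
    · simp
    · simp [PowerSeries.coeff_one, hi]
  add_mem' := by
    rintro a b ⟨A, hA⟩ ⟨B, hB⟩
    refine ⟨A + B, ?_⟩
    rintro _ ⟨i, rfl⟩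
    have h1 := hA ⟨i, rfl⟩
    have h2 := hB ⟨i, rfl⟩
    simp only at h1 h2
    calc ‖PowerSeries.coeff i (a + b)‖ * (s : ℝ) ^ i
        ≤ (‖PowerSeries.coeff i a‖ + ‖PowerSeries.coeff i b‖) * (s : ℝ) ^ i := by
          rw [map_add]; gcongr; exact norm_add_le _ _
      _ ≤ A + B := by linarith
  neg_mem' := by
    rintro a ⟨A, hA⟩
    refine ⟨A, ?_⟩
    rintro _ ⟨i, rfl⟩
    simpa using hA ⟨i, rfl⟩
  mul_mem' := by
    rintro a b ⟨A, hA⟩ ⟨B, hB⟩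
    have hA' : ∀ i : ℕ, ‖PowerSeries.coeff i a‖ * (s : ℝ) ^ i ≤ A := fun i => hA ⟨i, rfl⟩
    have hB' : ∀ i : ℕ, ‖PowerSeries.coeff i b‖ * (s : ℝ) ^ i ≤ B := fun i => hB ⟨i, rfl⟩
    have hA0 : 0 ≤ A := le_trans (by positivity) (hA' 0)
    refine ⟨A * B, ?_⟩
    rintro _ ⟨n, rfl⟩
    have hne : (Finset.HasAntidiagonal.antidiagonal n).Nonempty := ⟨(0, n), by simp⟩
    obtain ⟨⟨i, j⟩, hij, hle⟩ := IsUltrametricDist.exists_norm_finsetSum_le_of_nonempty hne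
      (fun p : ℕ × ℕ => PowerSeries.coeff p.1 a * PowerSeries.coeff p.2 b)
    rw [Finset.HasAntidiagonal.mem_antidiagonal] at hij
    simp only at hij hle
    change ‖PowerSeries.coeff n (a * b)‖ * (s : ℝ) ^ n ≤ A * B
    rw [PowerSeries.coeff_mul]
    calc _ ≤ ‖PowerSeries.coeff i a * PowerSeries.coeff j b‖ * (s : ℝ) ^ n := by gcongr
      _ = (‖PowerSeries.coeff i a‖ * (s : ℝ) ^ i) * (‖PowerSeries.coeff j b‖ * (s : ℝ) ^ j) := by
        rw [norm_mul, ← hij, pow_add]; ring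
      _ ≤ A * B := by
        gcongr
        · exact hA' i
        · exact hB' j

/-- The ring `K{X/r}` of power series that converge on the open disc of radius `r`: the
intersection of the rings `K[[X/s]]₀` for `0 < s < r`. -/
def convSeries (r : ℝ) : Subring (PowerSeries K) :=
  ⨅ s : {s : ℝ≥0 // 0 < s ∧ (s : ℝ) < r}, bddSeries K s

variable {K}

theorem mem_convSeries {r : ℝ} {a : PowerSeries K} :
    a ∈ convSeries K r ↔ ∀ s : ℝ≥0, 0 < s → (s : ℝ) < r →
      BddAbove (Set.range fun i : ℕ => ‖PowerSeries.coeff i a‖ * (s : ℝ) ^ i) := by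
  rw [convSeries, Subring.mem_iInf]
  exact ⟨fun h s h0 h1 => h ⟨s, h0, h1⟩, fun h s => h s s.2.1 s.2.2⟩

theorem dX_mem {r : ℝ} {a : PowerSeries K} (ha : a ∈ convSeries K r) : dX K a ∈ convSeries K r := by
  rw [mem_convSeries] at ha ⊢
  intro s h0 h1
  obtain ⟨A, hA⟩ := ha s h0 h1
  have h0' : (0 : ℝ) < s := h0
  refine ⟨A / s, ?_⟩
  rintro _ ⟨i, rfl⟩
  have h := hA ⟨i + 1, rfl⟩
  simp only at h ⊢
  rw [coeff_dX, norm_mul, le_div_iff₀ h0']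
  have h2 : ‖((i : K) + 1)‖ ≤ 1 := by
    exact_mod_cast IsUltrametricDist.norm_natCast_le_one K (i + 1)
  calc _ ≤ ‖PowerSeries.coeff (i + 1) a‖ * 1 * (s : ℝ) ^ i * s := by gcongr
    _ = ‖PowerSeries.coeff (i + 1) a‖ * (s : ℝ) ^ (i + 1) := by ring
    _ ≤ A := h

variable (K) in
/-- The derivation `∂_X` of `K{X/r}`. -/
def dXr (r : ℝ) : Der (convSeries K r) :=
  restrictDeriv (dX K) (convSeries K r) (fun _ h => dX_mem h)

theorem coeffD_mem {d : Der K} (hb : IsBdd d) {r : ℝ} {a : PowerSeries K}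
    (ha : a ∈ convSeries K r) : coeffD d a ∈ convSeries K r := by
  rw [mem_convSeries] at ha ⊢
  intro s h0 h1
  obtain ⟨A, hA⟩ := ha s h0 h1
  obtain ⟨C, hC⟩ := hb
  refine ⟨max C 0 * A, ?_⟩
  rintro _ ⟨i, rfl⟩
  have h := hA ⟨i, rfl⟩
  simp only at h ⊢
  rw [coeff_coeffD]
  calc _ ≤ max C 0 * ‖PowerSeries.coeff i a‖ * (s : ℝ) ^ i := by
        gcongr
        exact (hC _).trans (mul_le_mul_of_nonneg_right (le_max_left _ _) (norm_nonneg _))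
    _ = max C 0 * (‖PowerSeries.coeff i a‖ * (s : ℝ) ^ i) := by ring
    _ ≤ max C 0 * A := by gcongr

/-- The derivation of `K{X/r}` that applies `d` to every coefficient. -/
def coeffDr (d : Der K) (hb : IsBdd d) (r : ℝ) :
    Der (convSeries K r) :=
  restrictDeriv (coeffD d) (convSeries K r) (fun _ h => coeffD_mem hb h)

theorem C_mem (r : ℝ) (c : K) : PowerSeries.C c ∈ convSeries K r := by
  rw [mem_convSeries]
  intro s _ _
  refine ⟨‖c‖, ?_⟩
  rintro _ ⟨i, rfl⟩
  rcases eq_or_ne i 0 with rfl | hi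
  · simp
  · simp [PowerSeries.coeff_C, hi]

variable (K) in
/-- The constants `K → K{X/r}`, `c ↦ c X⁰`. -/
def constr (r : ℝ) : K →+* convSeries K r :=
  (PowerSeries.C (R := K)).codRestrict (convSeries K r) (C_mem r)

variable [CharZero K] {d : Der K}

theorem g0_mem (hb : IsBdd d) {r : ℝ} (hr : r ≤ genRadius d) (c : K) :
    g0 d c ∈ convSeries K r := by
  rw [mem_convSeries]
  intro s h0 h1
  have := taylor_bdd hb hr h0 h1 c
  simpa only [g0, RingHom.coe_mk, MonoidHom.coe_mk, OneHom.coe_mk, taylor,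
    PowerSeries.coeff_mk] using this

/-- The ring homomorphism `g_r : K → K{X/r}` induced by `g₀`, for `r ≤ r(K, d)`. -/
def gr (hb : IsBdd d) {r : ℝ} (hr : r ≤ genRadius d) : K →+* convSeries K r :=
  (g0 d).codRestrict (convSeries K r) (g0_mem hb hr)

theorem gr_d (hb : IsBdd d) {r : ℝ} (hr : r ≤ genRadius d) (c : K) :
    gr hb hr (d c) = dXr K r (gr hb hr c) := Subtype.ext (g0_d d c)

end Series

/-! ### The modules `f_{0*} L₀` and `f_{r*} L_r` -/

section Push

variable {K : Type*} [CommRing K] {d : Der K} {A : Type*} [CommRing A] {e : Der A}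

/-- For a homomorphism `g : (K, d) → (A, e)` of differential rings with associated homomorphism
`f : K⟨T⟩ → A⟨T⟩`, the left `K⟨T⟩`-module `f_* L(A, e)`. -/
abbrev PushTriv (g : K →+* A) (hg : ∀ c, g (d c) = e (g c)) : Type _ :=
  Restrict (TwistedPoly.map d e g hg) (Triv e)

/-- The identity map `A → f_* L(A, e)`. -/
def toPush (g : K →+* A) (hg : ∀ c, g (d c) = e (g c)) : A ≃+ PushTriv g hg :=
  (toTriv e).trans (toRestrict _ _)

variable (g : K →+* A) (hg : ∀ c, g (d c) = e (g c))

theorem C_smul_toPush (c : K) (a : A) :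
    TwistedPoly.C d c • toPush g hg a = toPush g hg (g c * a) := by
  change TwistedPoly.map d e g hg (TwistedPoly.C d c) • toTriv e a = toTriv e (g c * a)
  rw [TwistedPoly.map, TwistedPoly.lift_C, RingHom.comp_apply, Triv.C_smul]

theorem T_smul_toPush (a : A) : TwistedPoly.T d • toPush g hg a = toPush g hg (e a) := by
  change TwistedPoly.map d e g hg (TwistedPoly.T d) • toTriv e a = toTriv e (e a)
  rw [TwistedPoly.map, TwistedPoly.lift_T, Triv.T_smul]

/-- An additive endomorphism of `A` that commutes with `g(K)` and with `e`, as an endomorphism of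
the left `K⟨T⟩`-module `f_* L(A, e)`. -/
def endOfAdd (F : A →+ A) (hC : ∀ c a, F (g c * a) = g c * F a) (hT : ∀ a, F (e a) = e (F a)) :
    Module.End (TwistedPoly d) (PushTriv g hg) :=
  TwistedPoly.linearMapOfAdd
    (((toPush g hg).toAddMonoidHom.comp F).comp (toPush g hg).symm.toAddMonoidHom)
    (fun c x => by
      obtain ⟨a, rfl⟩ := (toPush g hg).surjective x
      simp [C_smul_toPush, hC])
    (fun x => by
      obtain ⟨a, rfl⟩ := (toPush g hg).surjective x
      simp [T_smul_toPush, hT])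

theorem endOfAdd_toPush (F : A →+ A) (hC : ∀ c a, F (g c * a) = g c * F a)
    (hT : ∀ a, F (e a) = e (F a)) (a : A) :
    endOfAdd g hg F hC hT (toPush g hg a) = toPush g hg (F a) := rfl

theorem end_push_ext {φ ψ : Module.End (TwistedPoly d) (PushTriv g hg)}
    (h : ∀ a, φ (toPush g hg a) = ψ (toPush g hg a)) : φ = ψ :=
  LinearMap.ext fun x => by
    obtain ⟨a, rfl⟩ := (toPush g hg).surjective x
    exact h a

/-- Multiplication by the values of `κ : K → A`, for `κ` with values in the constants of `(A, e)`, as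
a homomorphism from `K` to the endomorphism ring of `f_* L(A, e)`. -/
def constEnd (κ : K →+* A) (hκ : ∀ c, e (κ c) = 0) :
    K →+* Module.End (TwistedPoly d) (PushTriv g hg) where
  toFun c := endOfAdd g hg (AddMonoidHom.mulLeft (κ c))
    (fun b a => by simp only [AddMonoidHom.coe_mulLeft]; ring)
    (fun a => by simp [Der.leibniz, hκ])
  map_one' := end_push_ext g hg fun a => by
    change toPush g hg (κ 1 * a) = toPush g hg a
    rw [map_one, one_mul]
  map_mul' b c := end_push_ext g hg fun a => by
    change toPush g hg (κ (b * c) * a) = toPush g hg (κ b * (κ c * a))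
    rw [map_mul κ, mul_assoc]
  map_zero' := end_push_ext g hg fun a => by
    change toPush g hg (κ 0 * a) = 0
    rw [map_zero κ, zero_mul, map_zero]
  map_add' b c := end_push_ext g hg fun a => by
    change toPush g hg (κ (b + c) * a) = toPush g hg (κ b * a) + toPush g hg (κ c * a)
    rw [map_add κ, add_mul, map_add]

theorem constEnd_toPush (κ : K →+* A) (hκ : ∀ c, e (κ c) = 0) (c : K) (a : A) :
    constEnd g hg κ hκ c (toPush g hg a) = toPush g hg (κ c * a) := rfl

/-- The operator `D - e` on `f_* L(A, e)`, where `D` is a derivation of `A` that agrees with `e` on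
`g(K)` and commutes with `e`. -/
def subEnd (D : Der A) (hDg : ∀ c, D (g c) = e (g c)) (hDe : ∀ a, D (e a) = e (D a)) :
    Module.End (TwistedPoly d) (PushTriv g hg) :=
  endOfAdd g hg (D.toAddMonoidHom - e.toAddMonoidHom)
    (fun c a => by
      change D (g c * a) - e (g c * a) = g c * (D a - e a)
      rw [Der.leibniz, Der.leibniz, hDg]; ring)
    (fun a => by
      change D (e a) - e (e a) = e (D a - e a)
      rw [hDe, map_sub])

theorem subEnd_toPush (D : Der A) (hDg : ∀ c, D (g c) = e (g c)) (hDe : ∀ a, D (e a) = e (D a))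
    (a : A) : subEnd g hg D hDg hDe (toPush g hg a) = toPush g hg (D a - e a) := rfl

/-- The second left `K⟨T⟩`-structure on `f_* L(A, e)`, as a homomorphism to the endomorphism ring:
`c ∈ K` acts by multiplication by `κ(c)`, where `κ : K → A` takes values in the constants of
`(A, e)`, and `T` acts by `D - e`, where `D` is a derivation of `A` that extends `d` along
`κ`, agrees with `e` on `g(K)` and commutes with `e`. -/
def sharp (κ : K →+* A) (D : Der A) (hκ : ∀ c, e (κ c) = 0) (hDκ : ∀ c, D (κ c) = κ (d c))
    (hDg : ∀ c, D (g c) = e (g c)) (hDe : ∀ a, D (e a) = e (D a)) :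
    TwistedPoly d →+* Module.End (TwistedPoly d) (PushTriv g hg) :=
  TwistedPoly.lift d (constEnd g hg κ hκ) (subEnd g hg D hDg hDe)
    (fun c => end_push_ext g hg fun a => by
      rw [Module.End.mul_apply, LinearMap.add_apply, Module.End.mul_apply, constEnd_toPush,
        subEnd_toPush, subEnd_toPush, constEnd_toPush, constEnd_toPush, ← map_add,
        Der.leibniz, Der.leibniz, hκ, hDκ]
      congr 1
      ring)

theorem sharp_C (κ : K →+* A) (D : Der A) (hκ : ∀ c, e (κ c) = 0)
    (hDκ : ∀ c, D (κ c) = κ (d c)) (hDg : ∀ c, D (g c) = e (g c)) (hDe : ∀ a, D (e a) = e (D a))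
    (c : K) (a : A) :
    sharp g hg κ D hκ hDκ hDg hDe (TwistedPoly.C d c) (toPush g hg a) =
      toPush g hg (κ c * a) := by
  rw [sharp, TwistedPoly.lift_C]; rfl

theorem sharp_T (κ : K →+* A) (D : Der A) (hκ : ∀ c, e (κ c) = 0)
    (hDκ : ∀ c, D (κ c) = κ (d c)) (hDg : ∀ c, D (g c) = e (g c)) (hDe : ∀ a, D (e a) = e (D a))
    (a : A) :
    sharp g hg κ D hκ hDκ hDg hDe (TwistedPoly.T d) (toPush g hg a) =
      toPush g hg (D a - e a) := by
  rw [sharp, TwistedPoly.lift_T]; rfl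

end Push

section Modules

variable {K : Type*} [NontriviallyNormedField K] [CharZero K] (d : Der K)

/-- The ring homomorphism `f₀ : K⟨T⟩ → K[[X]]⟨T⟩` associated with `g₀`. -/
def f0 : TwistedPoly d →+* TwistedPoly (dX K) := TwistedPoly.map d (dX K) (g0 d) (g0_d d)

/-- The left `K⟨T⟩`-module `f_{0*} L₀`, where `L₀ = L(K[[X]], ∂_X)`. -/
abbrev L0 : Type _ := Restrict (f0 d) (Triv (dX K))

/-- The element of `f_{0*} L₀` given by a power series. -/
def toL0 : PowerSeries K ≃+ L0 d := toPush (g0 d) (g0_d d)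

/-- The second `K⟨T⟩`-structure on `f_{0*} L₀`: `c ∈ K` acts by `(aᵢ) ↦ (c aᵢ)` and `T` acts by
`(aᵢ) ↦ (d(aᵢ) - (i+1) aᵢ₊₁)`. -/
def sharp0 : TwistedPoly d →+* Module.End (TwistedPoly d) (L0 d) :=
  sharp (g0 d) (g0_d d) (PowerSeries.C (R := K)) (coeffD d)
    (fun c => by
      ext n
      rw [coeff_dX, PowerSeries.coeff_C]
      simp)
    (fun c => by
      ext n
      rw [coeff_coeffD, PowerSeries.coeff_C, PowerSeries.coeff_C]
      split_ifs <;> simp)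
    (coeffD_g0 d)
    (fun a => by
      ext n
      have h : d ((n : K) + 1) = 0 := by rw [map_add, Der.map_natCast_eq_zero]; simp
      rw [coeff_coeffD, coeff_dX, coeff_dX, coeff_coeffD, Der.leibniz, h]
      simp)

theorem C_smul_toL0 (c : K) (a : PowerSeries K) :
    TwistedPoly.C d c • toL0 d a = toL0 d (g0 d c * a) := C_smul_toPush _ _ c a

theorem T_smul_toL0 (a : PowerSeries K) :
    TwistedPoly.T d • toL0 d a = toL0 d (dX K a) := T_smul_toPush _ _ a

theorem sharp0_C (c : K) (a : PowerSeries K) :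
    sharp0 d (TwistedPoly.C d c) (toL0 d a) = toL0 d (PowerSeries.C c * a) := sharp_C ..

theorem sharp0_T (a : PowerSeries K) :
    sharp0 d (TwistedPoly.T d) (toL0 d a) = toL0 d (coeffD d a - dX K a) := sharp_T ..

variable {d} [IsUltrametricDist K] (hb : IsBdd d) {r : ℝ} (hr : r ≤ genRadius d)

/-- The ring homomorphism `f_r : K⟨T⟩ → K{X/r}⟨T⟩` associated with `g_r`. -/
def fr : TwistedPoly d →+* TwistedPoly (dXr K r) :=
  TwistedPoly.map d (dXr K r) (gr hb hr) (gr_d hb hr)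

/-- The left `K{X/r}⟨T⟩`-module `L_r = L(K{X/r}, ∂_X)`. -/
abbrev TrivR (K : Type*) [NontriviallyNormedField K] [IsUltrametricDist K] (r : ℝ) : Type _ :=
  Triv (dXr K r)

/-- The left `K⟨T⟩`-module `f_{r*} L_r`. -/
abbrev Lr : Type _ := Restrict (fr hb hr) (TrivR K r)

/-- The element of `f_{r*} L_r` given by a power series in `K{X/r}`. -/
def toLr : convSeries K r ≃+ Lr hb hr := toPush (gr hb hr) (gr_d hb hr)

/-- The second `K⟨T⟩`-structure on `f_{r*} L_r`: `c ∈ K` acts by `(aᵢ) ↦ (c aᵢ)` and `T` acts by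
`(aᵢ) ↦ (d(aᵢ) - (i+1) aᵢ₊₁)`. -/
def sharpR : TwistedPoly d →+* Module.End (TwistedPoly d) (Lr hb hr) :=
  sharp (gr hb hr) (gr_d hb hr) (constr K r) (coeffDr d hb r)
    (fun c => Subtype.ext (by
      ext n
      change PowerSeries.coeff n (dX K (PowerSeries.C c)) = PowerSeries.coeff n 0
      rw [coeff_dX, PowerSeries.coeff_C]
      simp))
    (fun c => Subtype.ext (by
      ext n
      change PowerSeries.coeff n (coeffD d (PowerSeries.C c)) =
        PowerSeries.coeff n (PowerSeries.C (d c))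
      rw [coeff_coeffD, PowerSeries.coeff_C, PowerSeries.coeff_C]
      split_ifs <;> simp))
    (fun c => Subtype.ext (coeffD_g0 d c))
    (fun a => Subtype.ext (by
      ext n
      change PowerSeries.coeff n (coeffD d (dX K a)) = PowerSeries.coeff n (dX K (coeffD d a))
      have h : d ((n : K) + 1) = 0 := by rw [map_add, Der.map_natCast_eq_zero]; simp
      rw [coeff_coeffD, coeff_dX, coeff_dX, coeff_coeffD, Der.leibniz, h]
      simp))

/-- The inclusion `f_{r*} L_r → f_{0*} L₀`. -/
def incl : Lr hb hr →ₗ[TwistedPoly d] L0 d :=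
  TwistedPoly.linearMapOfAdd
    (((toL0 d).toAddMonoidHom.comp (convSeries K r).subtype.toAddMonoidHom).comp
      (toLr hb hr).symm.toAddMonoidHom)
    (fun c x => by
      obtain ⟨a, rfl⟩ := (toLr hb hr).surjective x
      rw [show TwistedPoly.C d c • toLr hb hr a = toLr hb hr (gr hb hr c * a) from
        C_smul_toPush _ _ c a]
      exact (C_smul_toL0 d c a).symm)
    (fun x => by
      obtain ⟨a, rfl⟩ := (toLr hb hr).surjective x
      rw [show TwistedPoly.T d • toLr hb hr a = toLr hb hr (dXr K r a) from
        T_smul_toPush _ _ a]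
      exact (T_smul_toL0 d a).symm)

theorem incl_toLr (a : convSeries K r) : incl hb hr (toLr hb hr a) = toL0 d a := rfl

theorem incl_sharpR (p : TwistedPoly d) (x : Lr hb hr) :
    incl hb hr (sharpR hb hr p x) = sharp0 d p (incl hb hr x) := by
  have hC : ∀ (c : K) (x : Lr hb hr), incl hb hr (sharpR hb hr (TwistedPoly.C d c) x) =
      sharp0 d (TwistedPoly.C d c) (incl hb hr x) := by
    intro c x
    obtain ⟨a, rfl⟩ := (toLr hb hr).surjective x
    rw [incl_toLr, sharp0_C]
    exact congrArg (incl hb hr) (sharp_C (gr hb hr) (gr_d hb hr) (constr K r) (coeffDr d hb r) _ _ _ _ c a)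
  have hT : ∀ (x : Lr hb hr), incl hb hr (sharpR hb hr (TwistedPoly.T d) x) =
      sharp0 d (TwistedPoly.T d) (incl hb hr x) := by
    intro x
    obtain ⟨a, rfl⟩ := (toLr hb hr).surjective x
    rw [incl_toLr, sharp0_T]
    exact congrArg (incl hb hr) (sharp_T (gr hb hr) (gr_d hb hr) (constr K r) (coeffDr d hb r) _ _ _ _ a)
  have hTp : ∀ (i : ℕ) (x : Lr hb hr), incl hb hr (sharpR hb hr (TwistedPoly.T d ^ i) x) =
      sharp0 d (TwistedPoly.T d ^ i) (incl hb hr x) := by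
    intro i
    induction i with
    | zero => intro x; rw [pow_zero, map_one, map_one]; rfl
    | succ i ih =>
      intro x
      rw [pow_succ, map_mul, map_mul, Module.End.mul_apply, Module.End.mul_apply, ih, hT]
  induction p using TwistedPoly.induct with
  | h0 => rw [map_zero, map_zero]; exact map_zero _
  | hadd p q hp hq =>
    rw [map_add, map_add, LinearMap.add_apply, LinearMap.add_apply, map_add, hp, hq]
  | hm i b =>
    rw [TwistedPoly.monomial_eq, map_mul, map_mul, Module.End.mul_apply, Module.End.mul_apply,
      hC, hTp]

end Modules

/-! ### The dual functor `D`, the modules `Hom(M, f_{r*} L_r)` and `F_{(0,r)} M` -/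

section Dual

variable {K : Type*} [NontriviallyNormedField K] [CharZero K] (d : Der K)
variable (M : Type*) [AddCommGroup M] [Module (TwistedPoly d) M]

/-- `DM = Hom(M, f_{0*} L₀)`, a left `K⟨T⟩`-module. -/
abbrev Dual : Type _ := HomObj M (sharp0 d)

/-- The dimension over `K` of (the restriction to `K` of) a left `K⟨T⟩`-module. -/
def dimK : ℕ := Module.finrank K (Restrict (TwistedPoly.C d) M)

variable {M}

/-- The additive map `x ↦ (χ(Tⁱ x / i!))ᵢ` for a `K`-linear form `χ`. -/
def psiAux (χ : Restrict (TwistedPoly.C d) M →ₗ[K] K) : M →+ PowerSeries K where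
  toFun x := PowerSeries.mk fun i =>
    ((i.factorial : ℕ) : K)⁻¹ * χ (toRestrict _ M (TwistedPoly.T d ^ i • x))
  map_zero' := by ext; simp
  map_add' x y := by ext; simp [mul_add]

theorem coeff_psiAux (χ : Restrict (TwistedPoly.C d) M →ₗ[K] K) (x : M) (i : ℕ) :
    PowerSeries.coeff i (psiAux d χ x) =
      ((i.factorial : ℕ) : K)⁻¹ * χ (toRestrict _ M (TwistedPoly.T d ^ i • x)) := by
  simp [psiAux]

theorem psiAux_T (χ : Restrict (TwistedPoly.C d) M →ₗ[K] K) (x : M) :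
    psiAux d χ (TwistedPoly.T d • x) = dX K (psiAux d χ x) := by
  ext n
  rw [coeff_psiAux, coeff_dX, coeff_psiAux, ← mul_smul, ← pow_succ, Nat.factorial_succ]
  have h1 : ((n : K) + 1) ≠ 0 := by exact_mod_cast n.succ_ne_zero
  have h2 : ((n.factorial : ℕ) : K) ≠ 0 := by exact_mod_cast n.factorial_ne_zero
  push_cast
  field_simp

theorem psiAux_C (χ : Restrict (TwistedPoly.C d) M →ₗ[K] K) (c : K) (x : M) :
    psiAux d χ (TwistedPoly.C d c • x) = g0 d c * psiAux d χ x := by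
  suffices h : ∀ (n : ℕ) (c : K) (x : M),
      PowerSeries.coeff n (psiAux d χ (TwistedPoly.C d c • x)) =
        PowerSeries.coeff n (g0 d c * psiAux d χ x) from PowerSeries.ext fun n => h n c x
  intro n
  induction n with
  | zero =>
    intro c x
    have h0 : PowerSeries.coeff 0 (g0 d c) = c := coeff_zero_taylor d c
    rw [coeff_psiAux, PowerSeries.coeff_mul]
    simp only [Finset.Nat.antidiagonal_zero, Finset.sum_singleton, h0, coeff_psiAux,
      Nat.factorial_zero, Nat.cast_one, inv_one, one_mul, pow_zero, one_smul]
    rw [← smul_toRestrict, map_smul, smul_eq_mul]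
  | succ n ih =>
    intro c x
    have h1 : ((n : K) + 1) ≠ 0 := by exact_mod_cast n.succ_ne_zero
    refine mul_right_cancel₀ h1 ?_
    rw [← coeff_dX, ← coeff_dX, ← psiAux_T, ← mul_smul, TwistedPoly.T_mul_C, add_smul, mul_smul,
      map_add, map_add, ih, ih, psiAux_T, g0_d, Der.leibniz, map_add, add_comm]

/-- For a `K`-linear form `χ` on a left `K⟨T⟩`-module `M`, the homomorphism
`Ψ_M(χ) : M → f_{0*} L₀`, `x ↦ (χ(Tⁱ x / i!))ᵢ`. -/
def psi (χ : Restrict (TwistedPoly.C d) M →ₗ[K] K) : M →ₗ[TwistedPoly d] L0 d :=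
  TwistedPoly.linearMapOfAdd ((toL0 d).toAddMonoidHom.comp (psiAux d χ))
    (fun c x => by
      change toL0 d (psiAux d χ (TwistedPoly.C d c • x)) =
        TwistedPoly.C d c • toL0 d (psiAux d χ x)
      rw [C_smul_toL0, psiAux_C])
    (fun x => by
      change toL0 d (psiAux d χ (TwistedPoly.T d • x)) = TwistedPoly.T d • toL0 d (psiAux d χ x)
      rw [T_smul_toL0, psiAux_T])

theorem psi_apply (χ : Restrict (TwistedPoly.C d) M →ₗ[K] K) (x : M) :
    psi d χ x = toL0 d (psiAux d χ x) := rfl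

/-- The `K`-linear form `s ↦ s(x)₀` on `DM`, for `x ∈ M`. -/
def evalZero (x : M) : Restrict (TwistedPoly.C d) (Dual d M) →ₗ[K] K where
  toFun s := PowerSeries.coeff 0 ((toL0 d).symm (HomObj.toHom (ρ := sharp0 d) s x))
  map_add' s t := by
    change PowerSeries.coeff 0 ((toL0 d).symm
      (HomObj.toHom (ρ := sharp0 d) s x + HomObj.toHom (ρ := sharp0 d) t x)) = _
    rw [map_add, map_add]
  map_smul' c s := by
    change PowerSeries.coeff 0 ((toL0 d).symm (sharp0 d (TwistedPoly.C d c)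
      (HomObj.toHom (ρ := sharp0 d) s x))) = _
    obtain ⟨a, ha⟩ := (toL0 d).surjective (HomObj.toHom (ρ := sharp0 d) s x)
    rw [← ha, sharp0_C]
    simp

theorem evalZero_apply (x : M) (s : Dual d M) : evalZero d x (toRestrict _ _ s) =
    PowerSeries.coeff 0 ((toL0 d).symm (s.toHom x)) := rfl

/-- The element `Ψ_{DM}(s ↦ s(x)₀)` of `DDM`, for `x ∈ M`. -/
def biduAux (x : M) : Dual d (Dual d M) := psi d (evalZero d x)

/-- The `i`-th coefficient of `c_M(x)(s)`. -/
theorem coeff_biduAux (x : M) (s : Dual d M) (i : ℕ) :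
    PowerSeries.coeff i ((toL0 d).symm ((biduAux d x).toHom s)) = ((i.factorial : ℕ) : K)⁻¹ *
      PowerSeries.coeff 0 ((toL0 d).symm ((TwistedPoly.T d ^ i • s).toHom x)) :=
  coeff_psiAux d (evalZero d x) s i

theorem dual_ext {N : Type*} [AddCommGroup N] [Module (TwistedPoly d) N] {φ ψ : Dual d N}
    (h : ∀ (s : N) (i : ℕ), PowerSeries.coeff i ((toL0 d).symm (φ.toHom s)) =
      PowerSeries.coeff i ((toL0 d).symm (ψ.toHom s))) : φ = ψ :=
  LinearMap.ext fun s => (toL0 d).symm.injective (PowerSeries.ext fun i => h s i)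

/-- The canonical morphism `c_M : M → DDM`: the composition of the evaluation `M → D₀D₀M`,
`x ↦ (χ ↦ χ(x))`, with the isomorphism `D₀D₀M ≅ DDM`.  Explicitly,
`c_M(x)(s) = ((Tⁱ s / i!)(x)₀)ᵢ`. -/
def biduality : M →ₗ[TwistedPoly d] Dual d (Dual d M) :=
  TwistedPoly.linearMapOfAdd (N' := Dual d (Dual d M))
    { toFun := biduAux d
      map_zero' := dual_ext d fun s i => by
        rw [coeff_biduAux, map_zero, map_zero, map_zero, mul_zero]
        change 0 = PowerSeries.coeff i ((toL0 d).symm 0)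
        rw [map_zero, map_zero]
      map_add' := fun x y => dual_ext d fun s i => by
        rw [HomObj.add_toHom, map_add, map_add, coeff_biduAux, coeff_biduAux, coeff_biduAux,
          map_add, map_add, map_add, mul_add] }
    (fun c x => dual_ext d fun s n => by
      change PowerSeries.coeff n ((toL0 d).symm ((biduAux d (TwistedPoly.C d c • x)).toHom s)) =
        PowerSeries.coeff n ((toL0 d).symm ((TwistedPoly.C d c • biduAux d x).toHom s))
      rw [HomObj.smul_toHom, coeff_biduAux, map_smul]
      obtain ⟨a, ha⟩ := (toL0 d).surjective ((TwistedPoly.T d ^ n • s).toHom x)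
      obtain ⟨b, hb⟩ := (toL0 d).surjective ((biduAux d x).toHom s)
      have h := coeff_biduAux d x s n
      rw [← hb, ← ha, AddEquiv.symm_apply_apply, AddEquiv.symm_apply_apply] at h
      rw [← ha, ← hb, C_smul_toL0, sharp0_C, AddEquiv.symm_apply_apply,
        AddEquiv.symm_apply_apply, PowerSeries.coeff_C_mul, h]
      have h0 : PowerSeries.coeff 0 (g0 d c) = c := coeff_zero_taylor d c
      rw [PowerSeries.coeff_mul]
      simp only [Finset.Nat.antidiagonal_zero, Finset.sum_singleton, h0]
      ring)
    (fun x => dual_ext d fun s n => by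
      change PowerSeries.coeff n ((toL0 d).symm ((biduAux d (TwistedPoly.T d • x)).toHom s)) =
        PowerSeries.coeff n ((toL0 d).symm ((TwistedPoly.T d • biduAux d x).toHom s))
      rw [HomObj.smul_toHom, coeff_biduAux, map_smul]
      obtain ⟨a, ha⟩ := (toL0 d).surjective ((TwistedPoly.T d ^ n • s).toHom x)
      obtain ⟨b, hb⟩ := (toL0 d).surjective ((biduAux d x).toHom s)
      have h := coeff_biduAux d x s n
      have h' := coeff_biduAux d x s (n + 1)
      rw [pow_succ', mul_smul, HomObj.smul_toHom, ← hb, ← ha, sharp0_T, AddEquiv.symm_apply_apply,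
        AddEquiv.symm_apply_apply, map_sub, coeff_coeffD, Nat.factorial_succ] at h'
      rw [← hb, ← ha, AddEquiv.symm_apply_apply, AddEquiv.symm_apply_apply] at h
      rw [← ha, ← hb, T_smul_toL0, sharp0_T, AddEquiv.symm_apply_apply,
        AddEquiv.symm_apply_apply, map_sub, coeff_coeffD, coeff_dX (n := n), h, h']
      have h1 : ((n : K) + 1) ≠ 0 := by exact_mod_cast n.succ_ne_zero
      have h2 : ((n.factorial : ℕ) : K) ≠ 0 := by exact_mod_cast n.factorial_ne_zero
      have h3 : d (((n.factorial : ℕ) : K)⁻¹ * PowerSeries.coeff 0 a) =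
          ((n.factorial : ℕ) : K)⁻¹ * d (PowerSeries.coeff 0 a) := by
        refine mul_left_cancel₀ h2 ?_
        have h4 : ∀ x : K, ((n.factorial : ℕ) : K) * d x = d (((n.factorial : ℕ) : K) * x) := by
          intro x
          rw [Der.leibniz, Der.map_natCast_eq_zero, zero_mul, zero_add]
        rw [h4, mul_inv_cancel_left₀ h2, mul_inv_cancel_left₀ h2]
      rw [h3]
      push_cast
      field_simp
      ring)

theorem biduality_apply (x : M) : biduality d x = biduAux d x := rfl

variable {d} [IsUltrametricDist K] (hb : IsBdd d) {r : ℝ} (hr : r ≤ genRadius d)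
variable (M)

/-- The left `K⟨T⟩`-module `Hom(M, f_{r*} L_r)`. -/
abbrev HomLr : Type _ := HomObj M (sharpR hb hr)

/-- The morphism `Hom(M, f_{r*} L_r) → Hom(M, f_{0*} L₀) = DM` induced by the inclusion
`f_{r*} L_r → f_{0*} L₀`. -/
def homIncl : HomLr M hb hr →ₗ[TwistedPoly d] Dual d M where
  toFun s := (incl hb hr).comp s.toHom
  map_add' s t := LinearMap.comp_add s.toHom t.toHom (incl hb hr)
  map_smul' p s := LinearMap.ext fun x => incl_sharpR hb hr p (s.toHom x)

/-- `F_{(0,r)} M = {x ∈ M ; c_M(x)(s) = 0 for all s ∈ Hom(M, f_{r*} L_r)}`. -/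
def Fminus : Submodule (TwistedPoly d) M where
  carrier := {x | ∀ s : HomLr M hb hr, (biduality d x).toHom (homIncl M hb hr s) = 0}
  zero_mem' s := by rw [map_zero]; rfl
  add_mem' {x y} hx hy s := by
    rw [map_add, HomObj.add_toHom, hx s, hy s, add_zero]
  smul_mem' p x hx s := by
    rw [map_smul, HomObj.smul_toHom, hx s, map_zero]

end Dual

/-! ### The multiplicity function `m(M)` -/

section Multiplicity

variable {K : Type*} [NontriviallyNormedField K] (d : Der K)

section

variable (N : Type*) [AddCommGroup N] [Module (TwistedPoly d) N]
  [Module.Finite K (Restrict (TwistedPoly.C d) N)]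

/-- An ultrametric norm on a finite-dimensional left `K⟨T⟩`-module: the maximum norm with respect to
a chosen basis over `K`.  (Any two norms are equivalent, so the spectral norm of an operator does
not depend on this choice.) -/
def supNorm (x : N) : ℝ :=
  ‖(Module.finBasis K (Restrict (TwistedPoly.C d) N)).equivFun (toRestrict _ N x)‖

/-- `ω(K) / |T|_sp` for the operator `T` on `N`. -/
def specRadius [IsUltrametricDist K] : ℝ :=
  omega K / spNorm (supNorm d N) (fun x => TwistedPoly.T d • x)

end

variable (M : Type*) [AddCommGroup M] [Module (TwistedPoly d) M]

/-- Restriction of submodules from `K⟨T⟩` to `K`. -/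
def restrictSubmodule :
    Submodule (TwistedPoly d) M ↪o Submodule K (Restrict (TwistedPoly.C d) M) where
  toFun P :=
    { carrier := {x | (toRestrict _ M).symm x ∈ P}
      zero_mem' := P.zero_mem
      add_mem' := P.add_mem
      smul_mem' := fun c _ hx => P.smul_mem (TwistedPoly.C d c) hx }
  inj' P Q h := by
    ext x
    exact SetLike.ext_iff.mp h x
  map_rel_iff' := Iff.rfl

variable [Module.Finite K (Restrict (TwistedPoly.C d) M)]

theorem isNoetherian_of_finite : IsNoetherian (TwistedPoly d) M :=
  isNoetherian_iff'.mpr (restrictSubmodule d M).wellFoundedGT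

theorem isArtinian_of_finite : IsArtinian (TwistedPoly d) M :=
  (restrictSubmodule d M).wellFoundedLT

instance (P : Submodule (TwistedPoly d) M) :
    Module.Finite K (Restrict (TwistedPoly.C d) P) :=
  Module.Finite.of_injective (restrictMap (TwistedPoly.C d) P.subtype) P.injective_subtype

instance (P : Submodule (TwistedPoly d) M) :
    Module.Finite K (Restrict (TwistedPoly.C d) (M ⧸ P)) :=
  Module.Finite.of_surjective (restrictMap (TwistedPoly.C d) P.mkQ) P.mkQ_surjective

/-- A composition series `0 = M₀ ⊂ M₁ ⊂ … ⊂ M_n = M` exists. -/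
theorem exists_compositionSeries : ∃ s : CompositionSeries (Submodule (TwistedPoly d) M),
    s.head = ⊥ ∧ s.last = ⊤ :=
  have := isNoetherian_of_finite d M
  have := isArtinian_of_finite d M
  exists_compositionSeries_of_isNoetherian_isArtinian (TwistedPoly d) M

/-- A chosen composition series of `M`. -/
def compSeries : CompositionSeries (Submodule (TwistedPoly d) M) :=
  (exists_compositionSeries d M).choose

/-- The `i`-th Jordan–Hölder factor `Mᵢ₊₁ / Mᵢ` of `M`. -/
abbrev Factor (i : Fin (compSeries d M).length) : Type _ :=
  (compSeries d M i.succ : Submodule (TwistedPoly d) M) ⧸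
    (compSeries d M i.castSucc).submoduleOf (compSeries d M i.succ)

variable [IsUltrametricDist K]

open Classical in
/-- The function `m(M)`: the value at `t` is the sum of the dimensions of the Jordan–Hölder factors
of `M` for which `ω(K) / |T|_sp = t`. -/
def mult (t : ℝ) : ℕ :=
  ∑ i : Fin (compSeries d M).length,
    if specRadius d (Factor d M i) = t then dimK d (Factor d M i) else 0

/-- `supp m(M) = {t ∈ (0, r(K, d)] ; m(M)(t) ≠ 0}`. -/
def multSupp : Set ℝ := {t | t ∈ Set.Ioc 0 (genRadius d) ∧ mult d M t ≠ 0}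

end Multiplicity

/-! ### Matrices of the powers of `T` -/

section Matrices

variable {K : Type*} [NontriviallyNormedField K] (d : Der K)
variable {M : Type*} [AddCommGroup M] [Module (TwistedPoly d) M]

/-- The matrix `G_k` of the multiplication by `T^k` with respect to a basis `(eᵢ)`:
`T^k eᵢ = ∑ⱼ (G_k)ᵢⱼ eⱼ`. -/
def matT {m : ℕ} (e : Module.Basis (Fin m) K (Restrict (TwistedPoly.C d) M)) (k : ℕ) :
    Matrix (Fin m) (Fin m) K :=
  Matrix.of fun i j =>
    e.repr (toRestrict _ M (TwistedPoly.T d ^ k • (toRestrict _ M).symm (e i))) j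

/-- The maximum of the absolute values of the entries of a matrix. -/
def entryNorm {m : ℕ} (G : Matrix (Fin m) (Fin m) K) : ℝ≥0 :=
  Finset.univ.sup fun i => Finset.univ.sup fun j => ‖G i j‖₊

/-- `limsup |G_i|^(1/i)`, as an element of `[0, ∞]`. -/
def growth {m : ℕ} (e : Module.Basis (Fin m) K (Restrict (TwistedPoly.C d) M)) : ℝ≥0∞ :=
  Filter.limsup (fun i : ℕ => (entryNorm (matT d e i) : ℝ≥0∞) ^ (1 / (i : ℝ))) Filter.atTop

end Matrices

end DiffMod

end

noncomputable section

namespace DiffMod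

/-! ### Spectral norms and growth of iterates -/

section SpectralNorm

variable {X : Type*} [Zero X] {N : X → ℝ} {f : X → X}

omit [Zero X] in
theorem iterate_le_of_le {C : ℝ} (hC : 0 ≤ C)
    (hf : ∀ x, N (f x) ≤ C * N x) (n : ℕ) (x : X) : N (f^[n] x) ≤ C ^ n * N x := by
  induction n with
  | zero => simp
  | succ n ih =>
    rw [Function.iterate_succ_apply']
    calc N (f (f^[n] x)) ≤ C * N (f^[n] x) := hf _
      _ ≤ C * (C ^ n * N x) := by gcongr
      _ = C ^ (n + 1) * N x := by ring

theorem spNorm_nonneg (hN : ∀ x, 0 ≤ N x) : 0 ≤ spNorm N f :=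
  Real.iInf_nonneg fun _ => Real.rpow_nonneg (opNorm_nonneg hN _) _

theorem exists_iterate_le_of_spNorm_lt (hN : ∀ x, 0 ≤ N x) (hN0 : N 0 = 0)
    (hN' : ∀ x, x ≠ 0 → 0 < N x) (hf0 : f 0 = 0) {C : ℝ} (hC : 0 ≤ C)
    (hf : ∀ x, N (f x) ≤ C * N x) {τ : ℝ} (hτ : 0 < τ) (h : spNorm N f < τ) :
    ∃ B : ℝ, 0 ≤ B ∧ ∀ n x, N (f^[n] x) ≤ B * τ ^ n * N x := by
  obtain ⟨i, hi⟩ := exists_lt_of_ciInf_lt h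
  have hi0 : 0 < (i : ℕ) := i.pos
  have hbd : BddAbove {c : ℝ | ∃ x : X, x ≠ 0 ∧ c = N (f^[(i : ℕ)] x) / N x} := by
    refine ⟨C ^ (i : ℕ), ?_⟩
    rintro _ ⟨x, hx, rfl⟩
    rw [div_le_iff₀ (hN' x hx)]
    exact iterate_le_of_le hC hf _ _
  have hop : opNorm N f^[(i : ℕ)] ≤ τ ^ (i : ℕ) := by
    have h0 := opNorm_nonneg hN f^[(i : ℕ)]
    rw [← Real.rpow_inv_natCast_pow h0 hi0.ne', ← one_div]
    exact pow_le_pow_left₀ (Real.rpow_nonneg h0 _) hi.le _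
  have hstep : ∀ x, N (f^[(i : ℕ)] x) ≤ τ ^ (i : ℕ) * N x := by
    intro x
    by_cases hx : x = 0
    · subst hx
      rw [Function.iterate_fixed hf0, hN0, mul_zero]
    · rw [← div_le_iff₀ (hN' x hx)]
      exact (le_csSup hbd ⟨x, hx, rfl⟩).trans hop
  have hq : ∀ q : ℕ, ∀ x, N (f^[(i : ℕ) * q] x) ≤ τ ^ ((i : ℕ) * q) * N x := by
    intro q x
    rw [Function.iterate_mul, pow_mul]
    exact iterate_le_of_le (by positivity) hstep q x
  refine ⟨∑ k ∈ Finset.range i, C ^ k / τ ^ k, by positivity, fun n x => ?_⟩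
  have hn : n = (i : ℕ) * (n / i) + n % i := (Nat.div_add_mod n i).symm
  have hle : C ^ (n % i) / τ ^ (n % i) ≤ ∑ k ∈ Finset.range i, C ^ k / τ ^ k :=
    Finset.single_le_sum (f := fun k => C ^ k / τ ^ k) (fun k _ => by positivity)
      (Finset.mem_range.mpr (Nat.mod_lt _ hi0))
  calc N (f^[n] x) = N (f^[(i : ℕ) * (n / i)] (f^[n % i] x)) := by
        rw [← Function.iterate_add_apply, ← hn]
    _ ≤ τ ^ ((i : ℕ) * (n / i)) * (C ^ (n % i) * N x) :=
        (hq _ _).trans (by gcongr; exact iterate_le_of_le hC hf _ _)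
    _ = C ^ (n % i) / τ ^ (n % i) * τ ^ n * N x := by
        conv_rhs => rw [show τ ^ n = τ ^ ((i : ℕ) * (n / i)) * τ ^ (n % i) by
          rw [← pow_add, ← hn]]
        field_simp
    _ ≤ _ := by
        have := hN x
        gcongr

theorem spNorm_le_of_iterate_le (hN : ∀ x, 0 ≤ N x) (hN' : ∀ x, x ≠ 0 → 0 < N x)
    {B τ : ℝ} (hτ : 0 ≤ τ) (h : ∀ n x, N (f^[n] x) ≤ B * τ ^ n * N x) : spNorm N f ≤ τ := by
  set B' := max B 1
  have hB' : 0 < B' := lt_max_of_lt_right one_pos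
  have hop : ∀ n : ℕ, opNorm N f^[n] ≤ B' * τ ^ n := fun n => by
    refine Real.sSup_le ?_ (by positivity)
    rintro _ ⟨x, hx, rfl⟩
    rw [div_le_iff₀ (hN' x hx)]
    refine (h n x).trans ?_
    have := hN x
    gcongr
    exact le_max_left _ _
  have hle : ∀ n : ℕ, spNorm N f ≤ B' ^ (1 / ((n + 1 : ℕ) : ℝ)) * τ := fun n => by
    have hbelow : BddBelow (Set.range fun i : ℕ+ => opNorm N (f^[(i : ℕ)]) ^ (1 / ((i : ℕ) : ℝ))) :=
      ⟨0, by rintro _ ⟨i, rfl⟩; exact Real.rpow_nonneg (opNorm_nonneg hN _) _⟩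
    refine (ciInf_le hbelow n.succPNat).trans ?_
    rw [Nat.succPNat_coe]
    refine (Real.rpow_le_rpow (opNorm_nonneg hN _) (hop n.succ) (by positivity)).trans ?_
    rw [Real.mul_rpow hB'.le (by positivity), one_div,
      Real.pow_rpow_inv_natCast hτ n.succ_ne_zero, ← one_div]
  refine ge_of_tendsto' (x := Filter.atTop) (f := fun n : ℕ => B' ^ (1 / ((n + 1 : ℕ) : ℝ)) * τ)
    ?_ hle
  have h1 : Filter.Tendsto (fun n : ℕ => 1 / ((n + 1 : ℕ) : ℝ)) Filter.atTop (nhds 0) := by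
    simpa using tendsto_one_div_add_atTop_nhds_zero_nat (𝕜 := ℝ)
  have h2 := ((Real.continuous_const_rpow hB'.ne').tendsto 0).comp h1
  rw [Real.rpow_zero] at h2
  simpa using h2.mul_const τ

end SpectralNorm

section Field

variable {K : Type*} [NontriviallyNormedField K]

theorem exists_norm_iterate_le_uniform {d : Der K} (hb : IsBdd d) {τ : ℝ} (hτ : 0 < τ)
    (h : spNorm (fun x : K => ‖x‖) d < τ) :
    ∃ B : ℝ, 0 ≤ B ∧ ∀ n c, ‖d^[n] c‖ ≤ B * τ ^ n * ‖c‖ := by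
  obtain ⟨C, hC⟩ := hb
  exact exists_iterate_le_of_spNorm_lt (N := fun x : K => ‖x‖) (fun x => norm_nonneg x) norm_zero
    (fun x hx => norm_pos_iff.mpr hx) (map_zero d) (le_max_right C 0)
    (fun x => (hC x).trans (mul_le_mul_of_nonneg_right (le_max_left _ _) (norm_nonneg _))) hτ h

variable [IsUltrametricDist K]

theorem omega_pos [CharZero K] : 0 < omega K := by
  unfold omega
  split_ifs with h
  · exact one_pos
  · exact Real.rpow_pos_of_pos (norm_pos_iff.mpr (Nat.cast_ne_zero.mpr h)) _

theorem exists_pow_log_le {b q : ℝ} (hb : 0 ≤ b) (hq : 1 < q) {p : ℕ} (hp : 1 < p) :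
    ∃ C : ℝ, ∀ n : ℕ, b ^ Nat.log p n ≤ C * q ^ n := by
  obtain ⟨k, hk⟩ := pow_unbounded_of_one_lt b (show (1 : ℝ) < p by exact_mod_cast hp)
  obtain ⟨C, hC⟩ := (tendsto_pow_const_div_const_pow_of_one_lt k hq).bddAbove_range
  refine ⟨max C 1, fun n => ?_⟩
  rcases eq_or_ne n 0 with rfl | hn
  · simp
  have h1 : (n : ℝ) ^ k / q ^ n ≤ C := hC ⟨n, rfl⟩
  rw [div_le_iff₀ (by positivity)] at h1
  calc b ^ Nat.log p n ≤ ((p : ℝ) ^ k) ^ Nat.log p n := by gcongr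
    _ = ((p : ℝ) ^ Nat.log p n) ^ k := by rw [← pow_mul, ← pow_mul, mul_comm]
    _ ≤ (n : ℝ) ^ k := by
        gcongr
        exact_mod_cast Nat.pow_log_le_self p hn
    _ ≤ C * q ^ n := h1
    _ ≤ max C 1 * q ^ n := by gcongr; exact le_max_left _ _

/-- `|n!|` grows at most like `(ω(K) q)ⁿ`, for every `q > 1`. -/
theorem exists_norm_factorial_le [CharZero K] {q : ℝ} (hq : 1 < q) :
    ∃ C : ℝ, ∀ n : ℕ, ‖((n.factorial : ℕ) : K)‖ ≤ C * (omega K * q) ^ n := by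
  by_cases h : resChar K = 0
  · refine ⟨1, fun n => (IsUltrametricDist.norm_natCast_le_one K _).trans ?_⟩
    rw [omega, if_pos h, one_mul, one_mul]
    exact one_le_pow₀ hq.le
  have hp : (resChar K).Prime := resChar_eq_zero_or_prime.resolve_left h
  have : Fact (resChar K).Prime := ⟨hp⟩
  have hω : 0 < omega K := omega_pos
  have hpos : 0 < ‖(resChar K : K)‖ := norm_pos_iff.mpr (Nat.cast_ne_zero.mpr h)
  have hp1 : (0 : ℝ) < (resChar K : ℝ) - 1 := by
    have : (1 : ℝ) < resChar K := by exact_mod_cast hp.one_lt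
    linarith
  have hωp : omega K ^ (resChar K - 1) = ‖(resChar K : K)‖ := by
    have : ((resChar K - 1 : ℕ) : ℝ) = (resChar K : ℝ) - 1 := by
      rw [Nat.cast_sub hp.one_lt.le, Nat.cast_one]
    rw [omega, if_neg h, ← this, one_div, Real.rpow_inv_natCast_pow hpos.le]
    have := hp.one_lt
    omega
  have hω1 : omega K ≤ 1 := by
    rw [omega, if_neg h]
    exact Real.rpow_le_one hpos.le norm_resChar_le_one (by positivity)
  set b := (‖(resChar K : K)‖)⁻¹
  obtain ⟨C, hC⟩ := exists_pow_log_le (b := b) (by positivity) hq hp.one_lt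
  refine ⟨b * C, fun n => ?_⟩
  have hS : ((resChar K).digits n).sum ≤ (resChar K - 1) * (Nat.log (resChar K) n + 1) := by
    rcases eq_or_ne n 0 with rfl | hn
    · simp
    rw [← Nat.length_digits _ n hp.one_lt hn, mul_comm, ← smul_eq_mul]
    refine List.sum_le_card_nsmul _ _ fun x hx => ?_
    have := Nat.digits_lt_base hp.one_lt hx
    omega
  have hle : ((resChar K).digits n).sum ≤ n := Nat.digit_sum_le _ _
  have hv := sub_one_mul_padicValNat_factorial (p := resChar K) n
  have h1 : ‖((n.factorial : ℕ) : K)‖ * omega K ^ ((resChar K).digits n).sum = omega K ^ n := by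
    rw [norm_natCast_eq_pow n.factorial_ne_zero hp, ← hωp, ← pow_mul, hv, ← pow_add,
      Nat.sub_add_cancel hle]
  have h2 : ‖(resChar K : K)‖ ^ (Nat.log (resChar K) n + 1) ≤
      omega K ^ ((resChar K).digits n).sum := by
    rw [← hωp, ← pow_mul]
    exact pow_le_pow_of_le_one hω.le hω1 hS
  have h3 : ‖((n.factorial : ℕ) : K)‖ * ‖(resChar K : K)‖ ^ (Nat.log (resChar K) n + 1) ≤
      omega K ^ n := by
    rw [← h1]
    gcongr
  calc ‖((n.factorial : ℕ) : K)‖ ≤ omega K ^ n * (b * b ^ Nat.log (resChar K) n) := by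
        rw [← pow_succ', inv_pow, ← div_eq_mul_inv, le_div_iff₀ (by positivity)]
        exact h3
    _ ≤ omega K ^ n * (b * (C * q ^ n)) := by
        gcongr
        exact hC n
    _ = b * C * (omega K * q) ^ n := by rw [mul_pow]; ring

end Field

/-! ### Growth of the powers of `T` on a differential module -/

section Growth

variable {K : Type*} [NontriviallyNormedField K] (d : Der K)
variable (M : Type*) [AddCommGroup M] [Module (TwistedPoly d) M]

/-- Multiplication by `T`, as an additive endomorphism of the underlying `K`-vector space. -/
def tMap : Restrict (TwistedPoly.C d) M →+ Restrict (TwistedPoly.C d) M where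
  toFun x := toRestrict _ M (TwistedPoly.T d • (toRestrict _ M).symm x)
  map_zero' := by simp
  map_add' x y := by simp

variable {M}

theorem tMap_toRestrict (x : M) :
    tMap d M (toRestrict _ M x) = toRestrict _ M (TwistedPoly.T d • x) := rfl

theorem tMap_iterate_toRestrict (n : ℕ) (x : M) :
    (tMap d M)^[n] (toRestrict _ M x) = toRestrict _ M (TwistedPoly.T d ^ n • x) := by
  induction n with
  | zero => simp
  | succ n ih => rw [Function.iterate_succ_apply', ih, tMap_toRestrict, pow_succ', mul_smul]

theorem tMap_smul (c : K) (x : Restrict (TwistedPoly.C d) M) :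
    tMap d M (c • x) = c • tMap d M x + d c • x := by
  change TwistedPoly.T d • TwistedPoly.C d c • (toRestrict _ M).symm x =
    TwistedPoly.C d c • TwistedPoly.T d • (toRestrict _ M).symm x +
      TwistedPoly.C d (d c) • (toRestrict _ M).symm x
  rw [← mul_smul, TwistedPoly.T_mul_C, add_smul, mul_smul]

theorem restrictMap_tMap {N : Type*} [AddCommGroup N] [Module (TwistedPoly d) N]
    (f : M →ₗ[TwistedPoly d] N) (x : Restrict (TwistedPoly.C d) M) :
    restrictMap _ f (tMap d M x) = tMap d N (restrictMap _ f x) :=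
  f.map_smul (TwistedPoly.T d) x

theorem restrictMap_tMap_iterate {N : Type*} [AddCommGroup N] [Module (TwistedPoly d) N]
    (f : M →ₗ[TwistedPoly d] N) (n : ℕ) (x : Restrict (TwistedPoly.C d) M) :
    restrictMap _ f ((tMap d M)^[n] x) = (tMap d N)^[n] (restrictMap _ f x) :=
  (Function.Semiconj.iterate_right (restrictMap_tMap d f) n).eq x

theorem tMap_iterate_sum {ι : Type*} (s : Finset ι) (x : ι → Restrict (TwistedPoly.C d) M)
    (n : ℕ) : (tMap d M)^[n] (∑ i ∈ s, x i) = ∑ i ∈ s, (tMap d M)^[n] (x i) := by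
  induction n with
  | zero => rfl
  | succ n ih => simp only [Function.iterate_succ_apply', ih, map_sum]

variable (M) in
/-- All coordinates of `Tⁿ x` are `O(τⁿ)`, for every `x ∈ M`. -/
def GrowthLE (τ : ℝ) : Prop :=
  ∀ (χ : Restrict (TwistedPoly.C d) M →ₗ[K] K) (x : Restrict (TwistedPoly.C d) M),
    ∃ B : ℝ, ∀ n : ℕ, ‖χ ((tMap d M)^[n] x)‖ ≤ B * τ ^ n

variable {d} {N : Type*} [AddCommGroup N] [Module (TwistedPoly d) N] {τ : ℝ}

theorem GrowthLE.of_injective (h : GrowthLE d N τ) (f : M →ₗ[TwistedPoly d] N)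
    (hf : Function.Injective f) : GrowthLE d M τ := by
  intro χ x
  obtain ⟨g, hg⟩ := LinearMap.exists_leftInverse_of_injective
    (restrictMap (TwistedPoly.C d) f) (LinearMap.ker_eq_bot.mpr hf)
  obtain ⟨B, hB⟩ := h (χ.comp g) (restrictMap _ f x)
  refine ⟨B, fun n => ?_⟩
  have := hB n
  rwa [← restrictMap_tMap_iterate, LinearMap.comp_apply, ← LinearMap.comp_apply g, hg] at this

theorem GrowthLE.of_surjective (h : GrowthLE d M τ) (f : M →ₗ[TwistedPoly d] N)
    (hf : Function.Surjective f) : GrowthLE d N τ := by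
  intro χ y
  obtain ⟨x, hx⟩ : ∃ x : Restrict (TwistedPoly.C d) M, restrictMap _ f x = y := hf y
  obtain ⟨B, hB⟩ := h (χ.comp (restrictMap _ f)) x
  refine ⟨B, fun n => ?_⟩
  have := hB n
  rwa [LinearMap.comp_apply, restrictMap_tMap_iterate, hx] at this

section Uniform

variable [CharZero K]

theorem form_tMap_iterate_smul (χ : Restrict (TwistedPoly.C d) M →ₗ[K] K) (c : K)
    (x : Restrict (TwistedPoly.C d) M) (n : ℕ) :
    χ ((tMap d M)^[n] (c • x)) = ∑ p ∈ Finset.HasAntidiagonal.antidiagonal n,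
      ((n.choose p.1 : ℕ) : K) * (d^[p.1] c * χ ((tMap d M)^[p.2] x)) := by
  obtain ⟨x, rfl⟩ := (toRestrict _ M).surjective x
  have h := congrArg (PowerSeries.coeff n) (psiAux_C d χ c x)
  have hf : ∀ k : ℕ, ((k.factorial : ℕ) : K) ≠ 0 := fun k => by exact_mod_cast k.factorial_ne_zero
  rw [coeff_psiAux, PowerSeries.coeff_mul, inv_mul_eq_iff_eq_mul₀ (hf n)] at h
  rw [smul_toRestrict, tMap_iterate_toRestrict, h, Finset.mul_sum]
  refine Finset.sum_congr rfl fun p hp => ?_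
  rw [Finset.HasAntidiagonal.mem_antidiagonal] at hp
  have hch : ((n.choose p.1 : ℕ) : K) * ((p.1.factorial : ℕ) : K) * ((p.2.factorial : ℕ) : K) =
      ((n.factorial : ℕ) : K) := by
    rw [← hp, Nat.choose_symm_add]
    exact_mod_cast Nat.add_choose_mul_factorial_mul_factorial p.1 p.2
  rw [coeff_psiAux, tMap_iterate_toRestrict, ← hch]
  change _ * (PowerSeries.coeff p.1 (taylor d c) * _) = _
  rw [taylor, PowerSeries.coeff_mk]
  have h1 := hf p.1
  have h2 := hf p.2
  field_simp

variable [IsUltrametricDist K]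

theorem norm_form_tMap_iterate_smul_le {A B : ℝ}
    (hA : ∀ n c, ‖d^[n] c‖ ≤ A * τ ^ n * ‖c‖) {χ : Restrict (TwistedPoly.C d) M →ₗ[K] K}
    {x : Restrict (TwistedPoly.C d) M} (hB : ∀ n : ℕ, ‖χ ((tMap d M)^[n] x)‖ ≤ B * τ ^ n)
    (n : ℕ) (c : K) : ‖χ ((tMap d M)^[n] (c • x))‖ ≤ A * B * τ ^ n * ‖c‖ := by
  have hne : (Finset.HasAntidiagonal.antidiagonal n).Nonempty := ⟨(0, n), by simp⟩
  rw [form_tMap_iterate_smul]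
  obtain ⟨⟨i, j⟩, hij, hle⟩ := IsUltrametricDist.exists_norm_finsetSum_le_of_nonempty hne
    fun p : ℕ × ℕ => ((n.choose p.1 : ℕ) : K) * (d^[p.1] c * χ ((tMap d M)^[p.2] x))
  rw [Finset.HasAntidiagonal.mem_antidiagonal] at hij
  simp only at hij hle
  refine hle.trans ?_
  have hB0 : 0 ≤ B := by simpa using (norm_nonneg _).trans (hB 0)
  rw [norm_mul, norm_mul]
  calc _ ≤ 1 * ((A * τ ^ i * ‖c‖) * (B * τ ^ j)) := by
        refine mul_le_mul (IsUltrametricDist.norm_natCast_le_one K _) ?_ (by positivity)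
          zero_le_one
        exact mul_le_mul (hA _ _) (hB _) (norm_nonneg _) ((norm_nonneg _).trans (hA _ _))
    _ = A * B * τ ^ n * ‖c‖ := by rw [← hij, pow_add]; ring

theorem exists_form_tMap_iterate_le {A : ℝ} (hτ : 0 ≤ τ)
    (hA : ∀ n c, ‖d^[n] c‖ ≤ A * τ ^ n * ‖c‖) {ι : Type*} [Fintype ι]
    (e : Module.Basis ι K (Restrict (TwistedPoly.C d) M))
    (χ : Restrict (TwistedPoly.C d) M →ₗ[K] K)
    (h : ∀ k, ∃ B : ℝ, ∀ n : ℕ, ‖χ ((tMap d M)^[n] (e k))‖ ≤ B * τ ^ n) :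
    ∃ B : ℝ, 0 ≤ B ∧ ∀ n x, ‖χ ((tMap d M)^[n] x)‖ ≤ B * τ ^ n * ‖e.equivFun x‖ := by
  choose B hB using h
  have hB0 : ∀ k, 0 ≤ B k := fun k => by simpa using (norm_nonneg _).trans (hB k 0)
  have hA0 : 0 ≤ A := by simpa using (norm_nonneg _).trans (hA 0 1)
  refine ⟨∑ k, A * B k, Finset.sum_nonneg fun k _ => mul_nonneg hA0 (hB0 k), fun n x => ?_⟩
  conv_lhs => rw [← e.sum_equivFun x, tMap_iterate_sum, map_sum]
  rw [Finset.sum_mul, Finset.sum_mul]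
  refine (norm_sum_le _ _).trans (Finset.sum_le_sum fun k _ => ?_)
  refine (norm_form_tMap_iterate_smul_le hA (hB k) n _).trans ?_
  have h1 := hB0 k
  gcongr
  exact norm_le_pi_norm (e.equivFun x) k

theorem GrowthLE.of_basis {A : ℝ} (hτ : 0 ≤ τ) (hA : ∀ n c, ‖d^[n] c‖ ≤ A * τ ^ n * ‖c‖)
    {ι : Type*} [Fintype ι] (e : Module.Basis ι K (Restrict (TwistedPoly.C d) M))
    (h : ∀ i j, ∃ B : ℝ, ∀ n : ℕ, ‖e.coord j ((tMap d M)^[n] (e i))‖ ≤ B * τ ^ n) :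
    GrowthLE d M τ := by
  classical
  intro χ x
  have h' : ∀ j, ∃ B : ℝ, 0 ≤ B ∧
      ∀ n x, ‖e.coord j ((tMap d M)^[n] x)‖ ≤ B * τ ^ n * ‖e.equivFun x‖ :=
    fun j => exists_form_tMap_iterate_le hτ hA e _ fun i => h i j
  choose B hB0 hB using h'
  refine ⟨∑ j, ‖χ (e j)‖ * (B j * ‖e.equivFun x‖), fun n => ?_⟩
  rw [← e.sum_equivFun ((tMap d M)^[n] x), map_sum, Finset.sum_mul]
  refine (norm_sum_le _ _).trans (Finset.sum_le_sum fun j _ => ?_)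
  rw [map_smul, smul_eq_mul, norm_mul]
  calc _ ≤ (B j * τ ^ n * ‖e.equivFun x‖) * ‖χ (e j)‖ := by gcongr; exact hB j n x
    _ = _ := by ring

theorem GrowthLE.of_exact {Q : Type*} [AddCommGroup Q] [Module (TwistedPoly d) Q]
    [Module.Finite K (Restrict (TwistedPoly.C d) N)] {A : ℝ} (hτ : 0 < τ)
    (hA : ∀ n c, ‖d^[n] c‖ ≤ A * τ ^ n * ‖c‖) (hN : GrowthLE d N τ) (hQ : GrowthLE d Q τ)
    (i : N →ₗ[TwistedPoly d] M) (hi : Function.Injective i) (p : M →ₗ[TwistedPoly d] Q)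
    (hp : Function.Surjective p) (hip : ∀ x, p x = 0 → ∃ y, i y = x) : GrowthLE d M τ := by
  intro χ x
  obtain ⟨g, hg⟩ := LinearMap.exists_leftInverse_of_injective
    (restrictMap (TwistedPoly.C d) i) (LinearMap.ker_eq_bot.mpr hi)
  obtain ⟨σ, hσ⟩ := LinearMap.exists_rightInverse_of_surjective
    (restrictMap (TwistedPoly.C d) p) (LinearMap.range_eq_top.mpr hp)
  have hσ' : ∀ q, restrictMap _ p (σ q) = q := fun q => LinearMap.congr_fun hσ q
  have hig : ∀ z, restrictMap _ p z = 0 → restrictMap _ i (g z) = z := by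
    intro z hz
    obtain ⟨y, hy⟩ : ∃ y : Restrict (TwistedPoly.C d) N, restrictMap _ i y = z := hip z hz
    rw [← hy, ← LinearMap.comp_apply g, hg, LinearMap.id_apply]
  let β : Restrict (TwistedPoly.C d) Q →ₗ[K] Restrict (TwistedPoly.C d) N :=
    g.comp { toFun := fun q => tMap d M (σ q) - σ (tMap d Q q)
             map_add' := fun a b => by simp only [map_add]; abel
             map_smul' := fun c a => by
              rw [map_smul, tMap_smul, tMap_smul, map_add, map_smul, map_smul, RingHom.id_apply,
                smul_sub]
              abel }
  have hβ : ∀ q, restrictMap _ i (β q) = tMap d M (σ q) - σ (tMap d Q q) := fun q => by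
    refine hig _ ?_
    change restrictMap _ p (tMap d M (σ q) - σ (tMap d Q q)) = 0
    rw [map_sub, restrictMap_tMap, hσ', hσ', sub_self]
  have hsum : ∀ n q, (tMap d M)^[n] (σ q) = σ ((tMap d Q)^[n] q) +
      ∑ j ∈ Finset.range n, restrictMap _ i ((tMap d N)^[n - 1 - j] (β ((tMap d Q)^[j] q))) := by
    intro n q
    induction n with
    | zero => simp
    | succ n ih =>
      rw [Function.iterate_succ_apply', ih, map_add, map_sum, Finset.sum_range_succ,
        Nat.add_sub_cancel, Nat.sub_self, Function.iterate_zero_apply, hβ,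
        Function.iterate_succ_apply' (tMap d Q)]
      have : ∀ j ∈ Finset.range n,
          tMap d M (restrictMap _ i ((tMap d N)^[n - 1 - j] (β ((tMap d Q)^[j] q)))) =
          restrictMap _ i ((tMap d N)^[n - j] (β ((tMap d Q)^[j] q))) := by
        intro j hj
        rw [Finset.mem_range] at hj
        rw [← restrictMap_tMap, ← Function.iterate_succ_apply' (tMap d N),
          show (n - 1 - j).succ = n - j by omega]
      rw [Finset.sum_congr rfl this]
      abel
  set q := restrictMap _ p x
  let e := Module.finBasis K (Restrict (TwistedPoly.C d) N)
  obtain ⟨B₁, hB₁⟩ := hN (χ.comp (restrictMap _ i)) (g (x - σ q))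
  obtain ⟨B₂, hB₂⟩ := hQ (χ.comp σ) q
  obtain ⟨B₃, hB₃0, hB₃⟩ := exists_form_tMap_iterate_le hτ.le hA e (χ.comp (restrictMap _ i))
    fun k => hN _ _
  choose B₄ hB₄ using fun k => hQ ((e.coord k).comp β) q
  have hB₄0 : ∀ k, 0 ≤ B₄ k := fun k => by simpa using (norm_nonneg _).trans (hB₄ k 0)
  have hβq : ∀ j, ‖e.equivFun (β ((tMap d Q)^[j] q))‖ ≤ (∑ k, B₄ k) * τ ^ j := fun j => by
    refine (pi_norm_le_iff_of_nonneg
      (mul_nonneg (Finset.sum_nonneg fun k _ => hB₄0 k) (by positivity))).mpr fun k => ?_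
    refine (hB₄ k j).trans ?_
    gcongr
    exact Finset.single_le_sum (fun k _ => hB₄0 k) (Finset.mem_univ k)
  have hB₄s : 0 ≤ ∑ k, B₄ k := Finset.sum_nonneg fun k _ => hB₄0 k
  set B₅ := B₃ * (∑ k, B₄ k) / τ
  have hB₅ : 0 ≤ B₅ := by positivity
  have hx : x = restrictMap _ i (g (x - σ q)) + σ q := by
    rw [hig _ (by rw [map_sub, hσ', sub_self]), sub_add_cancel]
  refine ⟨B₁ + (B₂ + B₅), fun n => ?_⟩
  have h3 : ‖χ (∑ j ∈ Finset.range n, restrictMap _ i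
      ((tMap d N)^[n - 1 - j] (β ((tMap d Q)^[j] q))))‖ ≤ B₅ * τ ^ n := by
    rw [map_sum]
    refine IsUltrametricDist.norm_sum_le_of_forall_le_of_nonneg (by positivity) fun j hj => ?_
    rw [Finset.mem_range] at hj
    refine (hB₃ (n - 1 - j) _).trans ?_
    calc _ ≤ B₃ * τ ^ (n - 1 - j) * ((∑ k, B₄ k) * τ ^ j) := by gcongr; exact hβq j
      _ = B₅ * (τ ^ (n - 1 - j) * τ ^ j * τ) := by simp only [B₅]; field_simp
      _ = B₅ * τ ^ n := by
        rw [← pow_add, ← pow_succ, show n - 1 - j + j + 1 = n by omega]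
  calc ‖χ ((tMap d M)^[n] x)‖
      = ‖χ (restrictMap _ i ((tMap d N)^[n] (g (x - σ q)))) + (χ (σ ((tMap d Q)^[n] q)) +
          χ (∑ j ∈ Finset.range n, restrictMap _ i
            ((tMap d N)^[n - 1 - j] (β ((tMap d Q)^[j] q)))))‖ := by
        rw [← map_add, ← hsum, restrictMap_tMap_iterate, ← map_add, ← iterate_map_add, ← hx]
    _ ≤ B₁ * τ ^ n + (B₂ * τ ^ n + B₅ * τ ^ n) :=
        (norm_add_le _ _).trans (add_le_add (hB₁ n)
          ((norm_add_le _ _).trans (add_le_add (hB₂ n) h3)))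
    _ = _ := by ring

end Uniform

end Growth

section Criteria

variable {K : Type*} [NontriviallyNormedField K] [CharZero K] [IsUltrametricDist K] {d : Der K}
variable {M : Type*} [AddCommGroup M] [Module (TwistedPoly d) M]

/-! ### The spectral norm of `T` -/

omit [CharZero K] [IsUltrametricDist K] in
theorem exists_norm_tMap_le (hb : IsBdd d) {ι : Type*} [Fintype ι]
    (e : Module.Basis ι K (Restrict (TwistedPoly.C d) M)) :
    ∃ C : ℝ, 0 ≤ C ∧ ∀ x, ‖e.equivFun (tMap d M x)‖ ≤ C * ‖e.equivFun x‖ := by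
  obtain ⟨C, hC⟩ := hb
  have hC' : ∀ x, ‖d x‖ ≤ max C 0 * ‖x‖ := fun x =>
    (hC x).trans (mul_le_mul_of_nonneg_right (le_max_left _ _) (norm_nonneg _))
  refine ⟨∑ k, (‖e.equivFun (tMap d M (e k))‖ + max C 0 * ‖e.equivFun (e k)‖), by positivity,
    fun x => ?_⟩
  conv_lhs => rw [← e.sum_equivFun x, map_sum, map_sum]
  rw [Finset.sum_mul]
  refine (norm_sum_le _ _).trans (Finset.sum_le_sum fun k _ => ?_)
  have hk : ‖e.equivFun x k‖ ≤ ‖e.equivFun x‖ := norm_le_pi_norm _ k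
  rw [tMap_smul, map_add, map_smul, map_smul, add_mul]
  refine (norm_add_le _ _).trans (add_le_add ?_ ?_)
  · rw [norm_smul, mul_comm]
    gcongr
  · rw [norm_smul]
    calc _ ≤ max C 0 * ‖e.equivFun x k‖ * ‖e.equivFun (e k)‖ := by gcongr; exact hC' _
      _ ≤ max C 0 * ‖e.equivFun x‖ * ‖e.equivFun (e k)‖ := by gcongr
      _ = _ := by ring

variable (M) in
theorem spNorm_le_iff_growthLE [Module.Finite K (Restrict (TwistedPoly.C d) M)] (hb : IsBdd d)
    {c : ℝ} (hc : 0 < c) (hd : spNorm (fun x : K => ‖x‖) d ≤ c) :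
    spNorm (supNorm d M) (fun x => TwistedPoly.T d • x) ≤ c ↔ ∀ τ, c < τ → GrowthLE d M τ := by
  set e := Module.finBasis K (Restrict (TwistedPoly.C d) M)
  have hN : ∀ x, 0 ≤ supNorm d M x := fun x => norm_nonneg _
  have hN' : ∀ x, x ≠ 0 → 0 < supNorm d M x := fun x hx =>
    norm_pos_iff.mpr fun h => hx (e.equivFun.map_eq_zero_iff.mp h)
  have hit : ∀ n (x : M), supNorm d M ((fun x => TwistedPoly.T d • x)^[n] x) =
      ‖e.equivFun ((tMap d M)^[n] (toRestrict _ M x))‖ := fun n x => rfl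
  constructor
  · intro h τ hτ
    obtain ⟨A, -, hA⟩ := exists_norm_iterate_le_uniform hb (hc.trans hτ) (hd.trans_lt hτ)
    obtain ⟨C, hC0, hC⟩ := exists_norm_tMap_le hb e
    obtain ⟨B, hB0, hB⟩ := exists_iterate_le_of_spNorm_lt hN
      (by simp [supNorm]) hN' (smul_zero _) hC0 (fun x => hC (toRestrict _ M x)) (hc.trans hτ)
      (h.trans_lt hτ)
    refine GrowthLE.of_basis (hc.trans hτ).le hA e fun i j =>
      ⟨B * ‖e.equivFun (e i)‖, fun n => ?_⟩
    have h1 := hB n ((toRestrict _ M).symm (e i))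
    rw [hit] at h1
    refine (norm_le_pi_norm (e.equivFun ((tMap d M)^[n] (e i))) j).trans (h1.trans_eq ?_)
    rw [mul_right_comm]
    rfl
  · intro h
    refine le_of_forall_gt_imp_ge_of_dense fun τ hτ => ?_
    have hτ0 : 0 < τ := hc.trans hτ
    obtain ⟨A, -, hA⟩ := exists_norm_iterate_le_uniform hb hτ0 (hd.trans_lt hτ)
    choose B hB0 hB using fun j =>
      exists_form_tMap_iterate_le hτ0.le hA e (e.coord j) fun k => h τ hτ _ _
    refine spNorm_le_of_iterate_le (B := ∑ j, B j) hN hN' hτ0.le fun n x => ?_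
    rw [hit]
    have hB1 : 0 ≤ ∑ j, B j := Finset.sum_nonneg fun j _ => hB0 j
    refine (pi_norm_le_iff_of_nonneg (by have := hN x; positivity)).mpr fun j => ?_
    refine (hB j n (toRestrict _ M x)).trans ?_
    change _ ≤ (∑ j, B j) * τ ^ n * ‖e.equivFun (toRestrict _ M x)‖
    gcongr
    exact Finset.single_le_sum (fun j _ => hB0 j) (Finset.mem_univ j)

/-! ### Jordan–Hölder factors -/

section JordanHolder

variable [Module.Finite K (Restrict (TwistedPoly.C d) M)]

variable (M) in
theorem growthLE_iff_factor {A τ : ℝ} (hτ : 0 < τ) (hA : ∀ n c, ‖d^[n] c‖ ≤ A * τ ^ n * ‖c‖) :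
    GrowthLE d M τ ↔ ∀ i, GrowthLE d (Factor d M i) τ := by
  constructor
  · intro h i
    exact (h.of_injective (compSeries d M i.succ).subtype
      (Submodule.injective_subtype _)).of_surjective (Submodule.mkQ _)
      (Submodule.mkQ_surjective _)
  · intro h
    obtain ⟨h0, h1⟩ := (exists_compositionSeries d M).choose_spec
    change (compSeries d M).head = ⊥ at h0
    change (compSeries d M).last = ⊤ at h1
    have hall : ∀ i, GrowthLE d (compSeries d M i : Submodule (TwistedPoly d) M) τ := by
      intro i
      induction i using Fin.induction with
      | zero =>
        intro χ x
        have hx : x = 0 := by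
          have hx' : ((toRestrict (TwistedPoly.C d)
              (compSeries d M 0 : Submodule (TwistedPoly d) M)).symm x : M) ∈
                (⊥ : Submodule (TwistedPoly d) M) := by
            rw [← h0]
            exact ((toRestrict _ _).symm x).2
          exact Subtype.ext ((Submodule.mem_bot _).mp hx')
        exact ⟨0, fun n => by rw [hx, iterate_map_zero, map_zero, norm_zero, zero_mul]⟩
      | succ i ih =>
        have hle : compSeries d M i.castSucc ≤ compSeries d M i.succ :=
          ((compSeries d M).step i).le
        exact GrowthLE.of_exact hτ hA ih (h i) (Submodule.inclusion hle)
          (Submodule.inclusion_injective hle) (Submodule.mkQ _) (Submodule.mkQ_surjective _)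
          fun x hx => ⟨⟨x, (Submodule.Quotient.mk_eq_zero
            ((compSeries d M i.castSucc).submoduleOf (compSeries d M i.succ))).mp hx⟩, rfl⟩
    have hlast := hall (Fin.last _)
    have htop : ∀ x : M, x ∈ compSeries d M (Fin.last _) := fun x => by
      change x ∈ (compSeries d M).last
      rw [h1]
      exact Submodule.mem_top
    exact hlast.of_surjective (Submodule.subtype _) fun x => ⟨⟨x, htop x⟩, rfl⟩

omit [CharZero K] [IsUltrametricDist K] in
theorem dimK_factor_ne_zero (i : Fin (compSeries d M).length) : dimK d (Factor d M i) ≠ 0 := by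
  intro h
  have hs : Subsingleton (Factor d M i) :=
    Module.finrank_zero_iff (M := Restrict (TwistedPoly.C d) (Factor d M i)).mp h
  rw [Submodule.Quotient.subsingleton_iff] at hs
  have hlt := ((compSeries d M).step i).lt
  refine hlt.not_ge fun x hx => ?_
  have : (⟨x, hx⟩ : (compSeries d M i.succ : Submodule (TwistedPoly d) M)) ∈
      (compSeries d M i.castSucc).submoduleOf (compSeries d M i.succ) := by
    rw [hs]
    exact Submodule.mem_top
  exact this

variable (M) in
theorem multSupp_subset_iff {r : ℝ} (hr0 : 0 < r) (hr : r ≤ genRadius d) :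
    multSupp d M ⊆ Set.Icc r (genRadius d) ↔ ∀ i, spNorm (supNorm d (Factor d M i))
      (fun x => TwistedPoly.T d • x) ≤ omega K / r := by
  have hω : 0 < omega K := omega_pos
  have hsp : ∀ i, 0 ≤ spNorm (supNorm d (Factor d M i)) (fun x => TwistedPoly.T d • x) :=
    fun i => spNorm_nonneg fun x => norm_nonneg _
  constructor
  · intro h i
    rcases (hsp i).eq_or_lt with h0 | h0
    · rw [← h0]
      positivity
    rw [le_div_comm₀ h0 hr0]
    change r ≤ specRadius d (Factor d M i)
    rcases le_or_gt (specRadius d (Factor d M i)) (genRadius d) with h1 | h1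
    · refine (h ⟨⟨div_pos hω h0, h1⟩, ?_⟩).1
      refine (Finset.sum_pos' (fun _ _ => Nat.zero_le _) ⟨i, Finset.mem_univ i, ?_⟩).ne'
      rw [if_pos (by rfl)]
      exact Nat.pos_of_ne_zero (dimK_factor_ne_zero i)
    · exact hr.trans h1.le
  · rintro h t ⟨⟨ht0, ht⟩, hne⟩
    refine ⟨?_, ht⟩
    obtain ⟨i, -, hi⟩ := Finset.exists_ne_zero_of_sum_ne_zero hne
    have hi' : specRadius d (Factor d M i) = t := by
      by_contra hcon
      exact hi (if_neg hcon)
    have h0 : 0 < spNorm (supNorm d (Factor d M i)) (fun x => TwistedPoly.T d • x) := by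
      refine (hsp i).lt_of_ne fun h0 => ht0.ne ?_
      rw [← hi', specRadius, ← h0, div_zero]
    rw [← hi', specRadius, ← le_div_comm₀ h0 hr0]
    exact h i

end JordanHolder

/-! ### The growth of the matrices of `Tⁱ` -/

omit [CharZero K] [IsUltrametricDist K] in
theorem matT_apply {m : ℕ} (e : Module.Basis (Fin m) K (Restrict (TwistedPoly.C d) M)) (k : ℕ)
    (i j : Fin m) : matT d e k i j = e.coord j ((tMap d M)^[k] (e i)) := by
  obtain ⟨x, hx⟩ := (toRestrict _ M).surjective (e i)
  rw [matT, Matrix.of_apply, ← hx, tMap_iterate_toRestrict]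
  rfl

omit [CharZero K] [IsUltrametricDist K] in
theorem norm_le_entryNorm {m : ℕ} (G : Matrix (Fin m) (Fin m) K) (i j : Fin m) :
    ‖G i j‖ ≤ entryNorm G := by
  have h1 := Finset.le_sup (f := fun j => ‖G i j‖₊) (Finset.mem_univ j)
  have h2 := Finset.le_sup (f := fun i => Finset.univ.sup fun j => ‖G i j‖₊) (Finset.mem_univ i)
  exact_mod_cast h1.trans h2

omit [CharZero K] [IsUltrametricDist K] in
theorem entryNorm_le {m : ℕ} {G : Matrix (Fin m) (Fin m) K} {c : ℝ≥0}
    (h : ∀ i j, ‖G i j‖ ≤ c) : entryNorm G ≤ c :=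
  Finset.sup_le fun i _ => Finset.sup_le fun j _ => h i j

theorem growth_le_iff_growthLE (hb : IsBdd d) {c : ℝ} (hc : 0 < c)
    (hd : spNorm (fun x : K => ‖x‖) d ≤ c) {m : ℕ}
    (e : Module.Basis (Fin m) K (Restrict (TwistedPoly.C d) M)) :
    growth d e ≤ ENNReal.ofReal c ↔ ∀ τ, c < τ → GrowthLE d M τ := by
  constructor
  · intro h τ hτ
    have hτ0 : 0 < τ := hc.trans hτ
    obtain ⟨A, -, hA⟩ := exists_norm_iterate_le_uniform hb hτ0 (hd.trans_lt hτ)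
    have hlt : growth d e < ENNReal.ofReal τ :=
      h.trans_lt ((ENNReal.ofReal_lt_ofReal_iff hτ0).mpr hτ)
    have hev := Filter.eventually_lt_of_limsup_lt hlt
    refine GrowthLE.of_basis hτ0.le hA e fun i j => ?_
    have hbd : Filter.IsBoundedUnder (· ≤ ·) Filter.atTop
        fun n : ℕ => ‖e.coord j ((tMap d M)^[n] (e i))‖ / τ ^ n := by
      refine ⟨1, Filter.eventually_map.mpr ?_⟩
      filter_upwards [hev, Filter.eventually_gt_atTop 0] with n hn hn0
      rw [div_le_one (by positivity), ← matT_apply]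
      refine (norm_le_entryNorm _ i j).trans ?_
      have h1 : ((entryNorm (matT d e n) : ℝ≥0∞) ^ (1 / (n : ℝ))) ^ (n : ℝ) ≤
          ENNReal.ofReal τ ^ (n : ℝ) := ENNReal.rpow_le_rpow hn.le n.cast_nonneg
      rw [← ENNReal.rpow_mul, one_div_mul_cancel (by positivity), ENNReal.rpow_one,
        ENNReal.rpow_natCast, ← ENNReal.ofReal_pow hτ0.le, ← ENNReal.ofReal_coe_nnreal] at h1
      exact (ENNReal.ofReal_le_ofReal_iff (by positivity)).mp h1
    obtain ⟨B, hB⟩ := hbd.bddAbove_range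
    refine ⟨B, fun n => ?_⟩
    have := hB ⟨n, rfl⟩
    exact (div_le_iff₀ (by positivity)).mp this
  · intro h
    have hle : ∀ τ, c < τ → growth d e ≤ ENNReal.ofReal τ := by
      intro τ hτ
      obtain ⟨τ', h1, h2⟩ := exists_between hτ
      have hτ'0 : 0 < τ' := hc.trans h1
      have hτ0 : 0 < τ := hτ'0.trans h2
      have hgr : ∀ i j, ∀ᶠ n : ℕ in Filter.atTop, ‖matT d e n i j‖ ≤ τ ^ n := by
        intro i j
        obtain ⟨B, hB⟩ := h τ' h1 (e.coord j) (e i)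
        have ht : Filter.Tendsto (fun n : ℕ => B * (τ' / τ) ^ n) Filter.atTop (nhds (B * 0)) :=
          (tendsto_pow_atTop_nhds_zero_of_lt_one (by positivity)
            ((div_lt_one hτ0).mpr h2)).const_mul B
        rw [mul_zero] at ht
        filter_upwards [ht.eventually_le_const one_pos] with n hn
        rw [div_pow, ← mul_div_assoc, div_le_one (by positivity)] at hn
        rw [matT_apply]
        exact (hB n).trans hn
      refine Filter.limsup_le_of_le (h := ?_)
      filter_upwards [Filter.eventually_all.mpr fun i => Filter.eventually_all.mpr (hgr i),
        Filter.eventually_gt_atTop 0] with n hn hn0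
      have h3 : entryNorm (matT d e n) ≤ τ.toNNReal ^ n := by
        refine entryNorm_le fun i j => ?_
        rw [NNReal.coe_pow, Real.coe_toNNReal _ hτ0.le]
        exact hn i j
      calc (entryNorm (matT d e n) : ℝ≥0∞) ^ (1 / (n : ℝ))
          ≤ ((τ.toNNReal ^ n : ℝ≥0) : ℝ≥0∞) ^ (1 / (n : ℝ)) :=
            ENNReal.rpow_le_rpow (by exact_mod_cast h3) (by positivity)
        _ = ENNReal.ofReal τ := by
            rw [ENNReal.coe_pow, ← ENNReal.rpow_natCast, ← ENNReal.rpow_mul,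
              mul_one_div_cancel (by positivity), ENNReal.rpow_one]
            rfl
    refine le_of_forall_gt_imp_ge_of_dense fun a ha => ?_
    rcases eq_or_ne a ⊤ with rfl | ha'
    · exact le_top
    rw [← ENNReal.ofReal_toReal ha'] at ha ⊢
    exact hle _ ((ENNReal.ofReal_lt_ofReal_iff_of_nonneg hc.le).mp ha)

end Criteria

section Duality

variable {K : Type*} [NontriviallyNormedField K] [CharZero K] (d : Der K)
variable {M : Type*} [AddCommGroup M] [Module (TwistedPoly d) M]

/-! ### `DM` as the dual of the underlying vector space -/

theorem coeff_toHom (s : Dual d M) (n : ℕ) (x : M) :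
    PowerSeries.coeff n ((toL0 d).symm (s.toHom x)) = ((n.factorial : ℕ) : K)⁻¹ *
      PowerSeries.coeff 0 ((toL0 d).symm (s.toHom (TwistedPoly.T d ^ n • x))) := by
  induction n generalizing x with
  | zero => simp
  | succ n ih =>
    have h1 : ((n : K) + 1) ≠ 0 := by exact_mod_cast n.succ_ne_zero
    have h2 : ((n.factorial : ℕ) : K) ≠ 0 := by exact_mod_cast n.factorial_ne_zero
    have h := ih (TwistedPoly.T d • x)
    obtain ⟨a, ha⟩ := (toL0 d).surjective (s.toHom x)
    rw [map_smul, ← ha, T_smul_toL0, AddEquiv.symm_apply_apply, coeff_dX, ← mul_smul,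
      ← pow_succ] at h
    rw [← ha, AddEquiv.symm_apply_apply]
    refine mul_right_cancel₀ h1 (h.trans ?_)
    rw [Nat.factorial_succ]
    push_cast
    field_simp

/-- The linear form `x ↦ s(x)₀` for `s ∈ DM`. -/
def evalForm (s : Dual d M) : Restrict (TwistedPoly.C d) M →ₗ[K] K where
  toFun x := PowerSeries.coeff 0 ((toL0 d).symm (s.toHom ((toRestrict _ M).symm x)))
  map_add' x y := by simp only [map_add]
  map_smul' c x := by
    change PowerSeries.coeff 0 ((toL0 d).symm (s.toHom
      (TwistedPoly.C d c • (toRestrict _ M).symm x))) = _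
    obtain ⟨a, ha⟩ := (toL0 d).surjective (s.toHom ((toRestrict _ M).symm x))
    have h0 : PowerSeries.coeff 0 (g0 d c) = c := coeff_zero_taylor d c
    rw [map_smul, ← ha, C_smul_toL0, AddEquiv.symm_apply_apply, AddEquiv.symm_apply_apply,
      PowerSeries.coeff_mul]
    simp [h0]

theorem psi_evalForm (s : Dual d M) : psi d (evalForm d s) = s.toHom := by
  refine LinearMap.ext fun x => (toL0 d).symm.injective (PowerSeries.ext fun n => ?_)
  rw [psi_apply, AddEquiv.symm_apply_apply, coeff_psiAux, coeff_toHom]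
  rfl

theorem evalForm_psi (χ : Restrict (TwistedPoly.C d) M →ₗ[K] K) :
    evalForm d (psi d χ : Dual d M) = χ := by
  refine LinearMap.ext fun x => ?_
  change PowerSeries.coeff 0 (psiAux d χ ((toRestrict _ M).symm x)) = χ x
  rw [coeff_psiAux]
  simp

/-- The isomorphism `s ↦ (x ↦ s(x)₀)` between `DM` and the dual of the vector space `M`. -/
def dualEquiv : Restrict (TwistedPoly.C d) (Dual d M) ≃ₗ[K]
    Module.Dual K (Restrict (TwistedPoly.C d) M) where
  toFun s := evalForm d ((toRestrict _ (Dual d M)).symm s)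
  invFun χ := toRestrict _ (Dual d M) (psi d χ : Dual d M)
  map_add' s t := LinearMap.ext fun x => (evalZero d ((toRestrict _ M).symm x)).map_add s t
  map_smul' c s := LinearMap.ext fun x => (evalZero d ((toRestrict _ M).symm x)).map_smul c s
  left_inv _ := psi_evalForm d _
  right_inv χ := evalForm_psi d χ

instance [Module.Finite K (Restrict (TwistedPoly.C d) M)] :
    Module.Finite K (Restrict (TwistedPoly.C d) (Dual d M)) :=
  Module.Finite.equiv (dualEquiv d).symm

theorem dimK_dual [Module.Finite K (Restrict (TwistedPoly.C d) M)] :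
    dimK d (Dual d M) = dimK d M :=
  (dualEquiv d).finrank_eq.trans Subspace.dual_finrank_eq

end Duality

/-! ### Homomorphisms to `f_{r*} L_r` -/

section HomLr

variable {K : Type*} [NontriviallyNormedField K] [CharZero K] [IsUltrametricDist K] {d : Der K}
variable (hb : IsBdd d) {r : ℝ} (hr : r ≤ genRadius d)
variable (M : Type*) [AddCommGroup M] [Module (TwistedPoly d) M]

theorem incl_injective : Function.Injective (incl hb hr) := fun x y h => by
  obtain ⟨a, rfl⟩ := (toLr hb hr).surjective x
  obtain ⟨b, rfl⟩ := (toLr hb hr).surjective y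
  rw [incl_toLr, incl_toLr] at h
  exact congrArg _ (Subtype.ext ((toL0 d).injective h))

theorem homIncl_injective : Function.Injective (homIncl M hb hr) := fun s t h =>
  LinearMap.ext fun x => incl_injective hb hr (LinearMap.congr_fun (f := (incl hb hr).comp s.toHom)
    (g := (incl hb hr).comp t.toHom) h x)

variable {M} in
theorem mem_range_homIncl {s : Dual d M} :
    s ∈ (homIncl M hb hr).range ↔ ∀ x, (toL0 d).symm (s.toHom x) ∈ convSeries K r := by
  constructor
  · rintro ⟨t, rfl⟩ x
    exact ((toLr hb hr).symm (t.toHom x)).2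
  · intro h
    let F : M →+ Lr hb hr := (toLr hb hr).toAddMonoidHom.comp
      { toFun := fun x => ⟨(toL0 d).symm (s.toHom x), h x⟩
        map_zero' := Subtype.ext (by simp)
        map_add' := fun x y => Subtype.ext (by simp) }
    have hF : ∀ x, incl hb hr (F x) = s.toHom x := fun x => by
      change incl hb hr (toLr hb hr ⟨(toL0 d).symm (s.toHom x), h x⟩) = _
      rw [incl_toLr, AddEquiv.apply_symm_apply]
    refine ⟨(TwistedPoly.linearMapOfAdd F (fun c x => incl_injective hb hr ?_)
      fun x => incl_injective hb hr ?_ : M →ₗ[TwistedPoly d] Lr hb hr), LinearMap.ext hF⟩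
    · rw [hF, map_smul, map_smul, hF]
    · rw [hF, map_smul, map_smul, hF]

theorem homIncl_bijective_iff_psiAux_mem : Function.Bijective (homIncl M hb hr) ↔
    ∀ (χ : Restrict (TwistedPoly.C d) M →ₗ[K] K) x, psiAux d χ x ∈ convSeries K r := by
  constructor
  · intro h χ x
    exact (mem_range_homIncl hb hr).mp (h.2 (psi d χ)) x
  · intro h
    refine ⟨homIncl_injective hb hr M, fun s => (mem_range_homIncl hb hr).mpr fun x => ?_⟩
    rw [← psi_evalForm d s]
    exact h _ x

theorem homIncl_bijective_iff_growthLE (hr0 : 0 < r) : Function.Bijective (homIncl M hb hr) ↔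
    ∀ τ, omega K / r < τ → GrowthLE d M τ := by
  have hω : 0 < omega K := omega_pos
  have hf : ∀ n : ℕ, 0 < ‖((n.factorial : ℕ) : K)‖ := fun n =>
    norm_pos_iff.mpr (Nat.cast_ne_zero.mpr n.factorial_ne_zero)
  have hcoeff : ∀ (χ : Restrict (TwistedPoly.C d) M →ₗ[K] K) (x : M) (n : ℕ),
      ‖PowerSeries.coeff n (psiAux d χ x)‖ =
        ‖χ ((tMap d M)^[n] (toRestrict _ M x))‖ / ‖((n.factorial : ℕ) : K)‖ := fun χ x n => by
    rw [coeff_psiAux, norm_mul, norm_inv, tMap_iterate_toRestrict, inv_mul_eq_div]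
  rw [homIncl_bijective_iff_psiAux_mem]
  constructor
  · intro h τ hτ χ x
    obtain ⟨x, rfl⟩ := (toRestrict _ M).surjective x
    have hτ0 : 0 < τ := (by positivity : 0 < omega K / r).trans hτ
    obtain ⟨s, hs1, hs2⟩ := exists_between ((div_lt_comm₀ hr0 hτ0).mp hτ)
    have hs0 : 0 < s := (by positivity : 0 < omega K / τ).trans hs1
    lift s to ℝ≥0 using hs0.le
    obtain ⟨A, hA⟩ := mem_convSeries.mp (h χ x) s hs0 hs2
    have hA' : ∀ n, ‖PowerSeries.coeff n (psiAux d χ x)‖ * (s : ℝ) ^ n ≤ A := fun n => hA ⟨n, rfl⟩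
    have hA0 : 0 ≤ A := le_trans (by positivity) (hA' 0)
    have hq : 1 < τ * s / omega K := by
      rw [one_lt_div hω, mul_comm]
      exact (div_lt_iff₀ hτ0).mp hs1
    obtain ⟨C, hC⟩ := exists_norm_factorial_le (K := K) hq
    refine ⟨A * C, fun n => ?_⟩
    have h1 := hA' n
    have h2 := hC n
    rw [mul_div_cancel₀ _ hω.ne', mul_pow] at h2
    rw [hcoeff, div_mul_eq_mul_div, div_le_iff₀ (hf n)] at h1
    refine le_of_mul_le_mul_right ?_ (pow_pos hs0 n)
    calc _ ≤ A * ‖((n.factorial : ℕ) : K)‖ := h1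
      _ ≤ A * (C * (τ ^ n * (s : ℝ) ^ n)) := by gcongr
      _ = _ := by ring
  · intro h χ x
    refine mem_convSeries.mpr fun s hs0 hs => ?_
    have hs0' : (0 : ℝ) < s := hs0
    obtain ⟨B, hB⟩ := h (omega K / s) (by gcongr) χ (toRestrict _ M x)
    have hB0 : 0 ≤ B := by simpa using (norm_nonneg _).trans (hB 0)
    refine ⟨B, ?_⟩
    rintro _ ⟨n, rfl⟩
    simp only
    rw [hcoeff, div_mul_eq_mul_div, div_le_iff₀ (hf n)]
    calc _ ≤ B * (omega K / s) ^ n * (s : ℝ) ^ n := by gcongr; exact hB n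
      _ = B * omega K ^ n := by rw [div_pow]; field_simp
      _ ≤ _ := by gcongr; exact omega_pow_le_norm_factorial n

variable [Module.Finite K (Restrict (TwistedPoly.C d) M)]

instance : Module.Finite K (Restrict (TwistedPoly.C d) (HomLr M hb hr)) :=
  Module.Finite.of_injective (restrictMap (TwistedPoly.C d) (homIncl M hb hr))
    (homIncl_injective hb hr M)

theorem dimK_homLr_le : dimK d (HomLr M hb hr) ≤ dimK d M := by
  rw [← dimK_dual d (M := M)]
  exact LinearMap.finrank_le_finrank_of_injective
    (f := restrictMap (TwistedPoly.C d) (homIncl M hb hr)) (homIncl_injective hb hr M)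

theorem dimK_homLr_eq_iff :
    dimK d (HomLr M hb hr) = dimK d M ↔ Function.Bijective (homIncl M hb hr) := by
  rw [← dimK_dual d (M := M)]
  constructor
  · intro h
    have hinj := homIncl_injective hb hr M
    exact ⟨hinj, (LinearMap.injective_iff_surjective_of_finrank_eq_finrank
      (f := restrictMap (TwistedPoly.C d) (homIncl M hb hr)) h).mp hinj⟩
  · intro h
    exact (LinearEquiv.ofBijective (restrictMap (TwistedPoly.C d) (homIncl M hb hr)) h).finrank_eq

omit [Module.Finite K (Restrict (TwistedPoly.C d) M)] in
variable {M} in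
theorem mem_fminus_iff {x : M} : x ∈ Fminus M hb hr ↔
    ∀ t : HomLr M hb hr, evalForm d (homIncl M hb hr t) (toRestrict _ M x) = 0 := by
  have h (t : HomLr M hb hr) (n : ℕ) : PowerSeries.coeff n
      ((toL0 d).symm ((biduality d x).toHom (homIncl M hb hr t))) = ((n.factorial : ℕ) : K)⁻¹ *
        evalForm d (homIncl M hb hr (TwistedPoly.T d ^ n • t)) (toRestrict _ M x) := by
    rw [biduality_apply, coeff_biduAux, ← map_smul (homIncl M hb hr)]
    rfl
  constructor
  · intro hx t
    have h0 := h t 0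
    rw [hx t, pow_zero, one_smul] at h0
    simpa using h0.symm
  · intro hx t
    refine (toL0 d).symm.injective (PowerSeries.ext fun n => ?_)
    rw [h, hx, mul_zero, map_zero, map_zero]

theorem fminus_eq_bot_iff :
    Fminus M hb hr = ⊥ ↔ Function.Bijective (homIncl M hb hr) := by
  constructor
  · intro h
    refine ⟨homIncl_injective hb hr M, fun s => ?_⟩
    set W : Submodule K (Module.Dual K (Restrict (TwistedPoly.C d) M)) :=
      ((restrictMap (TwistedPoly.C d) (homIncl M hb hr)).range).map
        (dualEquiv d (M := M)).toLinearMap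
    have hbot : W.dualCoannihilator = ⊥ := by
      refine (Submodule.eq_bot_iff _).mpr fun x hx => ?_
      rw [Submodule.mem_dualCoannihilator] at hx
      exact (Submodule.eq_bot_iff _).mp h ((toRestrict _ M).symm x)
        ((mem_fminus_iff hb hr).mpr fun t => hx _ ⟨_, ⟨t, rfl⟩, rfl⟩)
    have htop : W = ⊤ := by
      rw [← Subspace.dualCoannihilator_dualAnnihilator_eq (W := W), hbot,
        Submodule.dualAnnihilator_bot]
    have hs : dualEquiv d (toRestrict _ (Dual d M) s) ∈ W := htop ▸ Submodule.mem_top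
    obtain ⟨_, ⟨t, rfl⟩, ht⟩ := hs
    exact ⟨t, (dualEquiv d).injective ht⟩
  · intro h
    refine (Submodule.eq_bot_iff _).mpr fun x hx => ?_
    refine (Module.forall_dual_apply_eq_zero_iff K
      (V := Restrict (TwistedPoly.C d) M) (toRestrict _ M x)).mp fun χ => ?_
    obtain ⟨t, ht⟩ := h.2 (psi d χ : Dual d M)
    have h0 := (mem_fminus_iff hb hr).mp hx t
    rwa [ht, evalForm_psi] at h0

end HomLr

/-! ### Gauss norms and units of `K{X/r}` -/

theorem exists_first_max {u : ℕ → ℝ} (hu : ∀ k, 0 ≤ u k)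
    (h : Filter.Tendsto u Filter.atTop (nhds 0)) :
    ∃ i, (∀ k, u k ≤ u i) ∧ ∀ k < i, u k < u i := by
  classical
  have hex : ∃ i, ∀ k, u k ≤ u i := by
    by_cases h0 : ∀ k, u k ≤ 0
    · exact ⟨0, fun k => (h0 k).trans (hu 0)⟩
    push Not at h0
    obtain ⟨j, hj⟩ := h0
    obtain ⟨N, hN⟩ := Filter.eventually_atTop.mp (h.eventually_le_const hj)
    obtain ⟨i, -, hi⟩ := Finset.exists_max_image (Finset.range (N + j + 1)) u ⟨0, by simp⟩
    refine ⟨i, fun k => ?_⟩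
    rcases lt_or_ge k (N + j + 1) with hk | hk
    · exact hi k (Finset.mem_range.mpr hk)
    · exact (hN k (by omega)).trans (hi j (Finset.mem_range.mpr (by omega)))
  refine ⟨Nat.find hex, Nat.find_spec hex, fun k hk => ?_⟩
  by_contra hlt
  push Not at hlt
  exact Nat.find_min hex hk fun l => (Nat.find_spec hex l).trans hlt

section Gauss

variable {K : Type*} [NontriviallyNormedField K] [IsUltrametricDist K]

theorem tendsto_coeff_mul_pow {r : ℝ} {a : PowerSeries K} (ha : a ∈ convSeries K r) {s : ℝ≥0}
    (hs : (s : ℝ) < r) :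
    Filter.Tendsto (fun i => ‖PowerSeries.coeff i a‖ * (s : ℝ) ^ i) Filter.atTop (nhds 0) := by
  obtain ⟨ρ, h1, h2⟩ := exists_between hs
  have hρ : 0 < ρ := s.2.trans_lt h1
  lift ρ to ℝ≥0 using hρ.le
  obtain ⟨A, hA⟩ := mem_convSeries.mp ha ρ hρ h2
  have ht : Filter.Tendsto (fun i : ℕ => A * ((s : ℝ) / ρ) ^ i) Filter.atTop (nhds (A * 0)) :=
    (tendsto_pow_atTop_nhds_zero_of_lt_one (by positivity) ((div_lt_one hρ).mpr h1)).const_mul A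
  rw [mul_zero] at ht
  refine squeeze_zero (fun i => by positivity) (fun i => ?_) ht
  have hi : ‖PowerSeries.coeff i a‖ * (ρ : ℝ) ^ i ≤ A := hA ⟨i, rfl⟩
  calc _ = ‖PowerSeries.coeff i a‖ * (ρ : ℝ) ^ i * ((s : ℝ) / ρ) ^ i := by
        rw [div_pow]; field_simp
    _ ≤ _ := by gcongr

/-- The Gauss norm of radius `s < r` on `K{X/r}` is multiplicative. -/
theorem gauss_mul_le {r : ℝ} {a b : PowerSeries K} (ha : a ∈ convSeries K r)
    (hb : b ∈ convSeries K r) {s : ℝ≥0} (hs : (s : ℝ) < r) {D : ℝ}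
    (hD : ∀ n, ‖PowerSeries.coeff n (a * b)‖ * (s : ℝ) ^ n ≤ D) (i j : ℕ) :
    (‖PowerSeries.coeff i a‖ * (s : ℝ) ^ i) * (‖PowerSeries.coeff j b‖ * (s : ℝ) ^ j) ≤ D := by
  classical
  set u : ℕ → ℝ := fun i => ‖PowerSeries.coeff i a‖ * (s : ℝ) ^ i with hu
  set v : ℕ → ℝ := fun i => ‖PowerSeries.coeff i b‖ * (s : ℝ) ^ i with hv
  have hu0 : ∀ k, 0 ≤ u k := fun k => by positivity
  have hv0 : ∀ k, 0 ≤ v k := fun k => by positivity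
  obtain ⟨k, hk1, hk2⟩ := exists_first_max hu0 (tendsto_coeff_mul_pow ha hs)
  obtain ⟨l, hl1, hl2⟩ := exists_first_max hv0 (tendsto_coeff_mul_pow hb hs)
  refine (mul_le_mul (hk1 i) (hl1 j) (hv0 j) (hu0 k)).trans ?_
  have hD0 : 0 ≤ D := le_trans (by positivity) (hD 0)
  rcases (mul_nonneg (hu0 k) (hv0 l)).eq_or_lt with h0 | h0
  · exact h0 ▸ hD0
  have huk : 0 < u k := pos_of_mul_pos_left h0 (hv0 l)
  have hvl : 0 < v l := pos_of_mul_pos_right h0 (hu0 k)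
  have hterm : ∀ p ∈ Finset.HasAntidiagonal.antidiagonal (k + l),
      ‖PowerSeries.coeff p.1 a * PowerSeries.coeff p.2 b‖ * (s : ℝ) ^ (k + l) = u p.1 * v p.2 := by
    intro p hp
    rw [← Finset.HasAntidiagonal.mem_antidiagonal.mp hp, norm_mul, pow_add]
    simp only [hu, hv]
    ring
  have hmem : (k, l) ∈ Finset.HasAntidiagonal.antidiagonal (k + l) := by simp
  by_contra hlt
  push Not at hlt
  have hsum := Finset.add_sum_erase _
    (fun p : ℕ × ℕ => PowerSeries.coeff p.1 a * PowerSeries.coeff p.2 b) hmem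
  rw [← PowerSeries.coeff_mul] at hsum
  have hspos : 0 < (s : ℝ) ^ (k + l) :=
    pos_of_mul_pos_right (h0.trans_eq (hterm _ hmem).symm) (norm_nonneg _)
  have hrest : ‖∑ p ∈ (Finset.HasAntidiagonal.antidiagonal (k + l)).erase (k, l),
      PowerSeries.coeff p.1 a * PowerSeries.coeff p.2 b‖ * (s : ℝ) ^ (k + l) < u k * v l := by
    rcases ((Finset.HasAntidiagonal.antidiagonal (k + l)).erase (k, l)).eq_empty_or_nonempty
      with he | he
    · rw [he, Finset.sum_empty, norm_zero, zero_mul]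
      exact h0
    obtain ⟨⟨x, y⟩, hp, hle⟩ := IsUltrametricDist.exists_norm_finsetSum_le_of_nonempty he
      fun p : ℕ × ℕ => PowerSeries.coeff p.1 a * PowerSeries.coeff p.2 b
    rw [Finset.mem_erase] at hp
    refine (mul_le_mul_of_nonneg_right hle hspos.le).trans_lt ?_
    rw [hterm _ hp.2]
    have hxy := Finset.HasAntidiagonal.mem_antidiagonal.mp hp.2
    simp only at hxy
    rcases lt_trichotomy x k with h | h | h
    · exact (mul_le_mul_of_nonneg_left (hl1 y) (hu0 x)).trans_lt
        (mul_lt_mul_of_pos_right (hk2 x h) hvl)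
    · exact absurd (Prod.ext h (by simp only; omega)) hp.1
    · exact mul_lt_mul' (hk1 x) (hl2 y (by omega)) (hv0 y) huk
  have hkl := hterm _ hmem
  simp only at hkl
  have h1 : PowerSeries.coeff k a * PowerSeries.coeff l b = PowerSeries.coeff (k + l) (a * b) -
      ∑ p ∈ (Finset.HasAntidiagonal.antidiagonal (k + l)).erase (k, l),
        PowerSeries.coeff p.1 a * PowerSeries.coeff p.2 b := by
    rw [← hsum, add_sub_cancel_right]
  rw [h1] at hkl
  refine lt_irrefl (u k * v l) ?_
  calc u k * v l = _ := hkl.symm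
    _ ≤ max ‖PowerSeries.coeff (k + l) (a * b)‖ ‖∑ p ∈
          (Finset.HasAntidiagonal.antidiagonal (k + l)).erase (k, l),
            PowerSeries.coeff p.1 a * PowerSeries.coeff p.2 b‖ * (s : ℝ) ^ (k + l) := by
        gcongr
        rw [sub_eq_add_neg, ← norm_neg (∑ p ∈ _, _)]
        exact IsUltrametricDist.norm_add_le_max _ _
    _ < u k * v l := by
        rw [max_mul_of_nonneg _ _ hspos.le]
        exact max_lt ((hD _).trans_lt hlt) hrest

omit [IsUltrametricDist K] in
theorem coeff_dX_iterate (a : PowerSeries K) (n k : ℕ) :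
    PowerSeries.coeff k ((dX K)^[n] a) =
      (((n + k).choose n * n.factorial : ℕ) : K) * PowerSeries.coeff (n + k) a := by
  induction n generalizing k with
  | zero => simp
  | succ n ih =>
    have h : (n + 1 + k).choose (n + 1) * (n + 1).factorial =
        (n + (k + 1)).choose n * n.factorial * (k + 1) := by
      have h1 := Nat.choose_succ_right_eq (n + (k + 1)) n
      rw [show n + (k + 1) - n = k + 1 by omega] at h1
      rw [show n + 1 + k = n + (k + 1) by ring, Nat.factorial_succ, ← mul_assoc, h1]
      ring
    rw [Function.iterate_succ_apply', coeff_dX, ih, h, show n + 1 + k = n + (k + 1) by ring]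
    push_cast
    ring

/-- If all derivatives of `w ∈ K{X/r}` are multiples of `w` by Taylor series, then the coefficients
of `w` are as small as those of a unit. -/
theorem norm_coeff_le_of_dX_iterate [CharZero K] {d : Der K} (hb : IsBdd d) {r : ℝ}
    (hr : r ≤ genRadius d) {w : PowerSeries K} (hw : w ∈ convSeries K r)
    (hw0 : PowerSeries.coeff 0 w = 1) (h : ∀ n, ∃ c, (dX K)^[n] w = g0 d c * w) {s : ℝ≥0}
    (hs0 : 0 < s) (hs : (s : ℝ) < r) (n : ℕ) : ‖PowerSeries.coeff n w‖ * (s : ℝ) ^ n ≤ 1 := by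
  have hs0' : (0 : ℝ) < s := hs0
  obtain ⟨j, hj, -⟩ := exists_first_max (fun k => by positivity) (tendsto_coeff_mul_pow hw hs)
  set W := ‖PowerSeries.coeff j w‖ * (s : ℝ) ^ j with hW
  have hW1 : 1 ≤ W := by simpa [hw0] using hj 0
  obtain ⟨c, hc⟩ := h n
  have hf : 0 < ‖((n.factorial : ℕ) : K)‖ :=
    norm_pos_iff.mpr (Nat.cast_ne_zero.mpr n.factorial_ne_zero)
  have hD : ∀ k, ‖PowerSeries.coeff k (g0 d c * w)‖ * (s : ℝ) ^ k ≤
      ‖((n.factorial : ℕ) : K)‖ * W / (s : ℝ) ^ n := by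
    intro k
    rw [← hc, coeff_dX_iterate, Nat.cast_mul, norm_mul, norm_mul, le_div_iff₀ (by positivity)]
    calc _ = ‖(((n + k).choose n : ℕ) : K)‖ * ‖((n.factorial : ℕ) : K)‖ *
          (‖PowerSeries.coeff (n + k) w‖ * (s : ℝ) ^ (n + k)) := by rw [pow_add]; ring
      _ ≤ 1 * ‖((n.factorial : ℕ) : K)‖ * W := by
          gcongr
          · exact IsUltrametricDist.norm_natCast_le_one K _
          · exact hj _
      _ = _ := by rw [one_mul]
  have h1 := gauss_mul_le (g0_mem hb hr c) hw hs hD 0 j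
  have h0 : PowerSeries.coeff 0 (g0 d c) = c := coeff_zero_taylor d c
  have hcn : c = ((n.factorial : ℕ) : K) * PowerSeries.coeff n w := by
    have := congrArg (PowerSeries.coeff 0) hc
    rw [coeff_dX_iterate, PowerSeries.coeff_mul] at this
    simpa [h0, hw0] using this.symm
  rw [h0, pow_zero, mul_one, ← hW, hcn, norm_mul, le_div_iff₀ (by positivity)] at h1
  have hpos : 0 < ‖((n.factorial : ℕ) : K)‖ * W := by positivity
  refine le_of_mul_le_mul_left ?_ hpos
  linarith

theorem inv_mem_convSeries {r : ℝ} {w : PowerSeries K} (hw0 : PowerSeries.coeff 0 w = 1)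
    (h : ∀ s : ℝ≥0, 0 < s → (s : ℝ) < r → ∀ n, ‖PowerSeries.coeff n w‖ * (s : ℝ) ^ n ≤ 1) :
    w⁻¹ ∈ convSeries K r := by
  refine mem_convSeries.mpr fun s hs0 hs => ⟨1, ?_⟩
  rintro _ ⟨n, rfl⟩
  simp only
  have hw0' : PowerSeries.constantCoeff w = 1 := by
    rwa [PowerSeries.coeff_zero_eq_constantCoeff] at hw0
  have hmul : w * w⁻¹ = 1 := PowerSeries.mul_inv_cancel _ (by rw [hw0']; exact one_ne_zero)
  induction n using Nat.strong_induction_on with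
  | _ n ih =>
    rcases eq_or_ne n 0 with rfl | hn
    · simp [hw0']
    have h1 := congrArg (PowerSeries.coeff n) hmul
    rw [PowerSeries.coeff_mul, PowerSeries.coeff_one, if_neg hn,
      Finset.Nat.sum_antidiagonal_eq_sum_range_succ_mk, Finset.sum_range_succ', hw0, one_mul,
      Nat.sub_zero, add_comm, add_eq_zero_iff_eq_neg] at h1
    rw [h1, norm_neg]
    have hs0' : (0 : ℝ) < s := hs0
    rw [← le_div_iff₀ (by positivity)]
    refine IsUltrametricDist.norm_sum_le_of_forall_le_of_nonneg (by positivity) fun k hk => ?_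
    rw [Finset.mem_range] at hk
    rw [le_div_iff₀ (by positivity), norm_mul]
    calc _ = (‖PowerSeries.coeff (k + 1) w‖ * (s : ℝ) ^ (k + 1)) *
          (‖PowerSeries.coeff (n - (k + 1)) w⁻¹‖ * (s : ℝ) ^ (n - (k + 1))) := by
          rw [mul_mul_mul_comm, ← pow_add, show k + 1 + (n - (k + 1)) = n by omega]
      _ ≤ 1 * 1 := by
          gcongr
          · exact h s hs0 hs _
          · exact ih _ (by omega)
      _ = 1 := one_mul 1

theorem isUnit_of_dX_eq [CharZero K] {d : Der K} (hb : IsBdd d) {r : ℝ} (hr : r ≤ genRadius d)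
    {w : convSeries K r} (hw0 : PowerSeries.coeff 0 (w : PowerSeries K) = 1) {a : K}
    (h : dXr K r w = gr hb hr a * w) : IsUnit w := by
  have hit : ∀ n, ∃ c, (dX K)^[n] (w : PowerSeries K) = g0 d c * w := by
    intro n
    induction n with
    | zero => exact ⟨1, by rw [map_one, one_mul]; rfl⟩
    | succ n ih =>
      obtain ⟨c, hc⟩ := ih
      refine ⟨d c + c * a, ?_⟩
      have h' : dX K (w : PowerSeries K) = g0 d a * w := congrArg Subtype.val h
      rw [Function.iterate_succ_apply', hc, Der.leibniz, h', ← g0_d, map_add, map_mul]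
      ring
  have hinv := inv_mem_convSeries hw0
    fun s hs0 hs => norm_coeff_le_of_dX_iterate hb hr w.2 hw0 hit hs0 hs
  refine IsUnit.of_mul_eq_one ⟨_, hinv⟩ (Subtype.ext (PowerSeries.mul_inv_cancel _ ?_))
  rw [← PowerSeries.coeff_zero_eq_constantCoeff, hw0]
  exact one_ne_zero

end Gauss

/-! ### The derivative of a determinant -/

section Det

variable {A : Type*} [CommRing A] (D : Der A)

theorem Der.map_prod {ι : Type*} [DecidableEq ι] (s : Finset ι) (f : ι → A) :
    D (∏ i ∈ s, f i) = ∑ i ∈ s, D (f i) * ∏ j ∈ s.erase i, f j := by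
  induction s using Finset.induction_on with
  | empty => simp
  | insert i s hi ih =>
    rw [Finset.prod_insert hi, Der.leibniz, ih, Finset.sum_insert hi, Finset.erase_insert hi,
      Finset.mul_sum]
    congr 1
    refine Finset.sum_congr rfl fun j hj => ?_
    rw [Finset.erase_insert_of_ne (fun h : i = j => hi (h ▸ hj)),
      Finset.prod_insert (fun h => hi (Finset.mem_of_mem_erase h))]
    ring

theorem Der.map_det {ι : Type*} [Fintype ι] [DecidableEq ι] (Y : Matrix ι ι A) :
    D Y.det = ∑ i, (Y.updateCol i fun j => D (Y j i)).det := by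
  simp only [Matrix.det_apply, map_sum]
  rw [Finset.sum_comm]
  refine Finset.sum_congr rfl fun σ _ => ?_
  have h : D (Equiv.Perm.sign σ • ∏ i, Y (σ i) i) =
      Equiv.Perm.sign σ • D (∏ i, Y (σ i) i) := by
    rcases Int.units_eq_one_or (Equiv.Perm.sign σ) with h | h <;> simp [h]
  rw [h, Der.map_prod, Finset.smul_sum]
  refine Finset.sum_congr rfl fun i _ => ?_
  congr 1
  rw [← Finset.mul_prod_erase _ _ (Finset.mem_univ i), Matrix.updateCol_self]
  congr 1
  refine Finset.prod_congr rfl fun j hj => ?_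
  rw [Matrix.updateCol_ne (Finset.ne_of_mem_erase hj)]

theorem Der.map_det_of_eq_sum {ι : Type*} [Fintype ι] [DecidableEq ι] {Y G : Matrix ι ι A}
    (h : ∀ j i, D (Y j i) = ∑ k, G i k * Y j k) : D Y.det = G.trace * Y.det := by
  rw [Der.map_det, Matrix.trace, Finset.sum_mul]
  refine Finset.sum_congr rfl fun i _ => ?_
  simp only [h]
  exact Matrix.det_updateCol_sum Y i (G i)

end Det

/-! ### Extension of scalars -/

section Extend

variable {R S : Type*} [Ring R] [Ring S] (f : R →+* S)
variable {M : Type*} [AddCommGroup M] [Module R M]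

/-- The class of `s ⊗ x` in `f^* M`. -/
def Extend.mk (s : S) (x : M) : Extend f M :=
  Submodule.Quotient.mk (p := Submodule.span S
    {x : S ⊗[ℤ] M | ∃ (s : S) (a : R) (m : M), x = (s * f a) ⊗ₜ[ℤ] m - s ⊗ₜ[ℤ] (a • m)}) (s ⊗ₜ[ℤ] x)

theorem Extend.smul_mk (s t : S) (x : M) : s • Extend.mk f t x = Extend.mk f (s * t) x := rfl

theorem Extend.mk_add (s : S) (x y : M) :
    Extend.mk f s (x + y) = Extend.mk f s x + Extend.mk f s y :=
  congrArg (Submodule.Quotient.mk (p := Submodule.span S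
    {x : S ⊗[ℤ] M | ∃ (s : S) (a : R) (m : M), x = (s * f a) ⊗ₜ[ℤ] m - s ⊗ₜ[ℤ] (a • m)}))
    (TensorProduct.tmul_add s x y)

theorem Extend.mk_smul (s : S) (a : R) (x : M) :
    Extend.mk f s (a • x) = Extend.mk f (s * f a) x :=
  Eq.symm <| (Submodule.Quotient.eq (Submodule.span S
    {x : S ⊗[ℤ] M | ∃ (s : S) (a : R) (m : M), x = (s * f a) ⊗ₜ[ℤ] m - s ⊗ₜ[ℤ] (a • m)})).mpr
    (Submodule.subset_span ⟨s, a, x, rfl⟩)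

/-- The unit `M → f_* f^* M` of the adjunction. -/
def Extend.unit : M →ₗ[R] Restrict f (Extend f M) where
  toFun x := toRestrict f _ (Extend.mk f 1 x)
  map_add' x y := by rw [Extend.mk_add, map_add]
  map_smul' a x := by
    rw [Extend.mk_smul, RingHom.id_apply, smul_toRestrict, Extend.smul_mk, one_mul, mul_one]

theorem Extend.induction {P : Extend f M → Prop} (hadd : ∀ x y, P x → P y → P (x + y))
    (h : ∀ s x, P (Extend.mk f s x)) (z : Extend f M) : P z := by
  obtain ⟨z, rfl⟩ := Submodule.Quotient.mk_surjective _ z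
  induction z using TensorProduct.induction_on with
  | zero =>
    have := h 0 0
    rwa [Extend.mk, TensorProduct.tmul_zero] at this
  | tmul s x => exact h s x
  | add x y hx hy => exact hadd _ _ hx hy

/-- The `S`-linear map `f^* M → N` adjoint to `M → f_* N`. -/
def Extend.lift {N : Type*} [AddCommGroup N] [Module S N] (φ : M →ₗ[R] Restrict f N) :
    Extend f M →ₗ[S] N :=
  Submodule.liftQ _
    (TensorProduct.AlgebraTensorModule.lift
      (LinearMap.toSpanSingleton S (M →ₗ[ℤ] N)
        (((toRestrict f N).symm.toAddMonoidHom.comp φ.toAddMonoidHom).toIntLinearMap)))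
    (Submodule.span_le.mpr (by
      rintro _ ⟨s, a, m, rfl⟩
      rw [SetLike.mem_coe, LinearMap.mem_ker, map_sub, TensorProduct.AlgebraTensorModule.lift_tmul,
        TensorProduct.AlgebraTensorModule.lift_tmul, sub_eq_zero]
      change (s * f a) • (toRestrict f N).symm (φ m) = s • (toRestrict f N).symm (φ (a • m))
      rw [map_smul, mul_smul]
      rfl))

theorem Extend.lift_mk {N : Type*} [AddCommGroup N] [Module S N] (φ : M →ₗ[R] Restrict f N)
    (s : S) (x : M) : Extend.lift f φ (Extend.mk f s x) = s • (toRestrict f N).symm (φ x) := rfl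

end Extend

section ExtendTwisted

variable {K A : Type*} [CommRing K] [CommRing A] {d : Der K} {e : Der A}
variable {M : Type*} [AddCommGroup M] [Module (TwistedPoly d) M]

/-- If the `xᵢ` generate `M` over `K`, then the `1 ⊗ xᵢ` generate `f^* M` over `A`. -/
theorem Extend.exists_eq_sum {f : TwistedPoly d →+* TwistedPoly e} {g : K → A}
    (hfC : ∀ c, f (TwistedPoly.C d c) = TwistedPoly.C e (g c))
    (hfT : f (TwistedPoly.T d) = TwistedPoly.T e) {ι : Type*} [Fintype ι] {x : ι → M}
    (hx : ∀ y : M, ∃ c : ι → K, y = ∑ i, TwistedPoly.C d (c i) • x i)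
    (z : Extend f M) :
    ∃ a : ι → A, z = ∑ i, TwistedPoly.C e (a i) • Extend.mk f 1 (x i) := by
  let P (z : Extend f M) : Prop :=
    ∃ a : ι → A, z = ∑ i, TwistedPoly.C e (a i) • Extend.mk f 1 (x i)
  have hadd : ∀ y z, P y → P z → P (y + z) := by
    rintro _ _ ⟨a, rfl⟩ ⟨b, rfl⟩
    refine ⟨a + b, ?_⟩
    simp only [Pi.add_apply, map_add, add_smul, Finset.sum_add_distrib]
  have hC : ∀ c z, P z → P (TwistedPoly.C e c • z) := by
    rintro c _ ⟨a, rfl⟩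
    refine ⟨fun i => c * a i, ?_⟩
    simp only [map_mul, mul_smul, Finset.smul_sum]
  have hsum : ∀ (s : Finset ι) (y : ι → Extend f M), (∀ i, P (y i)) → P (∑ i ∈ s, y i) := by
    intro s y hy
    exact Finset.sum_induction y P hadd ⟨0, by simp⟩ fun i _ => hy i
  have hone : ∀ y : M, P (Extend.mk f 1 y) := by
    intro y
    obtain ⟨c, hc⟩ := hx y
    refine ⟨fun i => g (c i), ?_⟩
    have h1 := map_sum (Extend.unit f (M := M)) (fun i => TwistedPoly.C d (c i) • x i) Finset.univ
    rw [← hc] at h1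
    refine h1.trans (Finset.sum_congr rfl fun i _ => ?_)
    rw [map_smul, ← hfC]
    rfl
  have hT : ∀ z, P z → P (TwistedPoly.T e • z) := by
    rintro _ ⟨a, rfl⟩
    rw [Finset.smul_sum]
    refine hsum _ _ fun i => ?_
    rw [← mul_smul, TwistedPoly.T_mul_C, add_smul, mul_smul]
    refine hadd _ _ (hC _ _ ?_) (hC _ _ (hone _))
    have := hone (TwistedPoly.T d • x i)
    rwa [Extend.mk_smul, hfT, one_mul, ← mul_one (TwistedPoly.T e), ← Extend.smul_mk] at this
  have hTp : ∀ (n : ℕ) z, P z → P (TwistedPoly.T e ^ n • z) := by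
    intro n
    induction n with
    | zero => intro z hz; rwa [pow_zero, one_smul]
    | succ n ih => intro z hz; rw [pow_succ', mul_smul]; exact hT _ (ih z hz)
  refine Extend.induction f (P := P) hadd (fun s y => ?_) z
  rw [← mul_one s, ← Extend.smul_mk]
  induction s using TwistedPoly.induct with
  | h0 => exact ⟨0, by simp⟩
  | hadd p q hp hq => rw [add_smul]; exact hadd _ _ hp hq
  | hm i b =>
    rw [TwistedPoly.monomial_eq, mul_smul]
    exact hC _ _ (hTp _ _ (hone y))

/-- Multiplication by a constant `c` of `(A, e)`, as an endomorphism of `L(A, e)`. -/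
def Triv.mulConst (c : A) (hc : e c = 0) : Triv e →ₗ[TwistedPoly e] Triv e :=
  TwistedPoly.linearMapOfAdd (Triv.mulEnd e c)
    (fun b x => by
      obtain ⟨a, rfl⟩ := (toTriv e).surjective x
      rw [Triv.C_smul]
      change toTriv e (c * (b * a)) = TwistedPoly.C e b • toTriv e (c * a)
      rw [Triv.C_smul, mul_left_comm])
    (fun x => by
      obtain ⟨a, rfl⟩ := (toTriv e).surjective x
      rw [Triv.T_smul]
      change toTriv e (c * e a) = TwistedPoly.T e • toTriv e (c * a)
      rw [Triv.T_smul, Der.leibniz, hc, zero_mul, zero_add])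

theorem Triv.mulConst_toTriv (c : A) (hc : e c = 0) (a : A) :
    Triv.mulConst c hc (toTriv e a) = toTriv e (c * a) := rfl

end ExtendTwisted

section Trivialization

variable {K : Type*} [NontriviallyNormedField K] [CharZero K] [IsUltrametricDist K] {d : Der K}
variable (hb : IsBdd d) {r : ℝ} (hr : r ≤ genRadius d)
variable (M : Type*) [AddCommGroup M] [Module (TwistedPoly d) M]
variable [Module.Finite K (Restrict (TwistedPoly.C d) M)]

omit [CharZero K] in
theorem dXr_constr (c : K) : dXr K r (constr K r c) = 0 := Subtype.ext (by
  ext n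
  change PowerSeries.coeff n (dX K (PowerSeries.C c)) = PowerSeries.coeff n 0
  rw [coeff_dX, PowerSeries.coeff_C]
  simp)

theorem sharpR_C (c : K) (a : convSeries K r) :
    sharpR hb hr (TwistedPoly.C d c) (toLr hb hr a) = toLr hb hr (constr K r c * a) :=
  sharp_C (gr hb hr) (gr_d hb hr) (constr K r) (coeffDr d hb r) _ _ _ _ c a

theorem fr_C (c : K) : fr hb hr (TwistedPoly.C d c) = TwistedPoly.C (dXr K r) (gr hb hr c) := by
  rw [fr, TwistedPoly.map, TwistedPoly.lift_C, RingHom.comp_apply]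

theorem fr_T : fr hb hr (TwistedPoly.T d) = TwistedPoly.T (dXr K r) := by
  rw [fr, TwistedPoly.map, TwistedPoly.lift_T]

theorem dimK_homLr_eq_of_equiv
    (Φ : Extend (fr hb hr) M ≃ₗ[TwistedPoly (dXr K r)] (Fin (dimK d M) → TrivR K r)) :
    dimK d (HomLr M hb hr) = dimK d M := by
  refine le_antisymm (dimK_homLr_le hb hr M) ?_
  let t (j : Fin (dimK d M)) : Restrict (TwistedPoly.C d) (HomLr M hb hr) :=
    toRestrict _ (HomLr M hb hr) ((restrictMap (fr hb hr)
      ((LinearMap.proj j).comp Φ.toLinearMap)).comp (Extend.unit (fr hb hr)) :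
        M →ₗ[TwistedPoly d] Lr hb hr)
  have hli : LinearIndependent K t := by
    refine Fintype.linearIndependent_iff.mpr fun c hc j => ?_
    let Λ : (Fin (dimK d M) → TrivR K r) →ₗ[TwistedPoly (dXr K r)] TrivR K r :=
      ∑ j, (Triv.mulConst (constr K r (c j)) (dXr_constr (c j))).comp (LinearMap.proj j)
    have hΛ1 : ∀ x : M, Λ (Φ (Extend.mk (fr hb hr) 1 x)) = 0 := by
      intro x
      let ev : Restrict (TwistedPoly.C d) (HomLr M hb hr) →+ Lr hb hr :=
        { toFun := fun s => ((toRestrict _ (HomLr M hb hr)).symm s).toHom x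
          map_zero' := rfl
          map_add' := fun _ _ => rfl }
      have hx : ev (∑ j, c j • t j) = 0 := by rw [hc, map_zero]
      rw [map_sum] at hx
      rw [LinearMap.sum_apply]
      refine Eq.trans (Finset.sum_congr rfl fun j _ => ?_) hx
      obtain ⟨a, ha⟩ := (toTriv (dXr K r)).surjective (Φ (Extend.mk (fr hb hr) 1 x) j)
      have h1 : ev (t j) = toLr hb hr a := ha.symm
      change _ = sharpR hb hr (TwistedPoly.C d (c j)) (ev (t j))
      rw [h1, sharpR_C, LinearMap.comp_apply, LinearMap.proj_apply, ← ha, Triv.mulConst_toTriv]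
      rfl
    have hΛ : ∀ z, Λ (Φ z) = 0 := by
      intro z
      induction z using Extend.induction with
      | hadd x y hx hy => rw [map_add, map_add, hx, hy, add_zero]
      | h s x =>
        rw [← mul_one s, ← Extend.smul_mk, map_smul, map_smul, hΛ1, smul_zero]
    have hj := hΛ (Φ.symm (Pi.single j (toTriv _ 1)))
    rw [LinearEquiv.apply_symm_apply, LinearMap.sum_apply, Finset.sum_eq_single j] at hj
    · rw [LinearMap.comp_apply, LinearMap.proj_apply, Pi.single_eq_same, Triv.mulConst_toTriv,
        mul_one] at hj
      have h1 := congrArg Subtype.val ((toTriv (dXr K r)).map_eq_zero_iff.mp hj)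
      exact PowerSeries.C_injective (h1.trans (map_zero _).symm)
    · intro i _ hi
      rw [LinearMap.comp_apply, LinearMap.proj_apply, Pi.single_eq_of_ne hi, map_zero]
    · simp
  have := hli.fintype_card_le_finrank
  rwa [Fintype.card_fin] at this

theorem nonempty_equiv_of_homIncl_bijective (h : Function.Bijective (homIncl M hb hr)) :
    Nonempty (Extend (fr hb hr) M ≃ₗ[TwistedPoly (dXr K r)] (Fin (dimK d M) → TrivR K r)) := by
  let b : Module.Basis (Fin (dimK d M)) K (Restrict (TwistedPoly.C d) M) := Module.finBasis K _
  have hmem := (homIncl_bijective_iff_psiAux_mem hb hr M).mp h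
  choose t ht using fun j : Fin (dimK d M) => h.2 (psi d (b.coord j) : Dual d M)
  let x (i : Fin (dimK d M)) : M := (toRestrict _ M).symm (b i)
  have hx : ∀ y : M, ∃ c : Fin (dimK d M) → K, y = ∑ i, TwistedPoly.C d (c i) • x i :=
    fun y => ⟨b.equivFun (toRestrict _ M y), (b.sum_equivFun (toRestrict _ M y)).symm⟩
  let Y : Matrix (Fin (dimK d M)) (Fin (dimK d M)) (convSeries K r) :=
    Matrix.of fun j i => ⟨psiAux d (b.coord j) (x i), hmem _ _⟩
  have htY : ∀ j i, (t j).toHom (x i) = toLr hb hr (Y j i) := by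
    intro j i
    refine incl_injective hb hr ?_
    exact LinearMap.congr_fun (f := (incl hb hr).comp (t j).toHom) (ht j) (x i)
  have hY0 : PowerSeries.coeff 0 (Y.det : PowerSeries K) = 1 := by
    have h1 := RingHom.map_det ((PowerSeries.constantCoeff (R := K)).comp (convSeries K r).subtype) Y
    have h2 : ((PowerSeries.constantCoeff (R := K)).comp (convSeries K r).subtype).mapMatrix Y =
        1 := by
      ext j i
      have h3 : PowerSeries.coeff 0 (psiAux d (b.coord j) (x i)) = b.coord j (b i) := by
        rw [coeff_psiAux]
        simp [x]
      rw [PowerSeries.coeff_zero_eq_constantCoeff, Module.Basis.coord_apply,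
        Module.Basis.repr_self, Finsupp.single_apply] at h3
      rw [Matrix.one_apply]
      simp only [eq_comm (a := j)]
      exact h3
    rw [h2, Matrix.det_one] at h1
    rw [PowerSeries.coeff_zero_eq_constantCoeff]
    exact h1
  obtain ⟨G, hG⟩ : ∃ G : Matrix (Fin (dimK d M)) (Fin (dimK d M)) K, ∀ i,
      TwistedPoly.T d • x i = ∑ k, TwistedPoly.C d (G i k) • x k :=
    ⟨_, fun i => (hx (TwistedPoly.T d • x i)).choose_spec⟩
  have hdet : dXr K r Y.det = gr hb hr G.trace * Y.det := by
    have h1 := Der.map_det_of_eq_sum (dXr K r) (Y := Y) (G := G.map (gr hb hr)) (by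
      intro j i
      refine Subtype.ext ?_
      change dX K (psiAux d (b.coord j) (x i)) = _
      rw [← psiAux_T, hG, map_sum]
      simp only [psiAux_C]
      exact (map_sum (convSeries K r).subtype (fun k => gr hb hr (G i k) * Y j k) _).symm)
    rw [h1]
    simp [Matrix.trace]
  have hunit : IsUnit Y := (Matrix.isUnit_iff_isUnit_det Y).mpr (isUnit_of_dX_eq hb hr hY0 hdet)
  let Φ : Extend (fr hb hr) M →ₗ[TwistedPoly (dXr K r)] (Fin (dimK d M) → TrivR K r) :=
    LinearMap.pi fun j => Extend.lift (fr hb hr) (t j).toHom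
  have hΦ : ∀ a : Fin (dimK d M) → convSeries K r,
      Φ (∑ i, TwistedPoly.C (dXr K r) (a i) • Extend.mk (fr hb hr) 1 (x i)) =
        fun j => toTriv _ (Y.mulVec a j) := by
    intro a
    funext j
    rw [LinearMap.pi_apply, map_sum, Matrix.mulVec, dotProduct, map_sum]
    refine Finset.sum_congr rfl fun i _ => ?_
    rw [map_smul, Extend.lift_mk, one_smul, htY, mul_comm]
    exact Triv.C_smul _ _ _
  refine ⟨LinearEquiv.ofBijective Φ ⟨?_, ?_⟩⟩
  · rw [injective_iff_map_eq_zero]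
    intro z hz
    obtain ⟨a, rfl⟩ := Extend.exists_eq_sum (fr_C hb hr) (fr_T hb hr) hx z
    have h0 : Y.mulVec a = Y.mulVec 0 := by
      rw [Matrix.mulVec_zero]
      funext j
      exact (toTriv (dXr K r)).map_eq_zero_iff.mp (congrFun ((hΦ a).symm.trans hz) j)
    rw [Matrix.mulVec_injective_of_isUnit hunit h0]
    simp
  · intro y
    obtain ⟨a, ha⟩ := Matrix.mulVec_surjective_iff_isUnit.mpr hunit
      fun j => (toTriv (dXr K r)).symm (y j)
    refine ⟨_, (hΦ a).trans ?_⟩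
    rw [ha]
    funext j
    exact AddEquiv.apply_symm_apply _ _

end Trivialization

end DiffMod

end

theorem mainTheorem8 {K : Type*} [NontriviallyNormedField K] [IsUltrametricDist K]
    [CompleteSpace K] [CharZero K] (d : DiffMod.Der K) (hd : ∃ x : K, d x ≠ 0)
    (hb : DiffMod.IsBdd d) {r : ℝ} (hr0 : 0 < r) (hr : r ≤ DiffMod.genRadius d)
    (M : Type*) [AddCommGroup M] [Module (DiffMod.TwistedPoly d) M]
    [Module.Finite K (DiffMod.Restrict (DiffMod.TwistedPoly.C d) M)]
    {m : ℕ} (e : Module.Basis (Fin m) K (DiffMod.Restrict (DiffMod.TwistedPoly.C d) M)) :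
    List.TFAE [
      DiffMod.dimK d (DiffMod.HomLr M hb hr) = DiffMod.dimK d M,
      Nonempty (DiffMod.Extend (DiffMod.fr hb hr) M
        ≃ₗ[DiffMod.TwistedPoly (DiffMod.dXr K r)]
          (Fin (DiffMod.dimK d M) → DiffMod.TrivR K r)),
      DiffMod.multSupp d M ⊆ Set.Icc r (DiffMod.genRadius d),
      Function.Bijective (DiffMod.homIncl M hb hr),
      ENNReal.ofReal r ≤ ENNReal.ofReal (DiffMod.omega K) / DiffMod.growth d e,
      DiffMod.Fminus M hb hr = ⊥] := by
  have hω : 0 < DiffMod.omega K := DiffMod.omega_pos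
  have hc : 0 < DiffMod.omega K / r := by positivity
  have hsp : DiffMod.spNorm (fun x : K => ‖x‖) d ≤ DiffMod.omega K / r := by
    have h0 : 0 ≤ DiffMod.spNorm (fun x : K => ‖x‖) d :=
      DiffMod.spNorm_nonneg fun x => norm_nonneg x
    have h1 : 0 < DiffMod.spNorm (fun x : K => ‖x‖) d := by
      refine h0.lt_of_ne fun h => (hr0.trans_le hr).ne ?_
      rw [DiffMod.genRadius, ← h, div_zero]
    rwa [le_div_comm₀ h1 hr0]
  tfae_have 1 ↔ 4 := DiffMod.dimK_homLr_eq_iff hb hr M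
  tfae_have 2 → 1 := fun ⟨Φ⟩ => DiffMod.dimK_homLr_eq_of_equiv hb hr M Φ
  tfae_have 4 → 2 := DiffMod.nonempty_equiv_of_homIncl_bijective hb hr M
  tfae_have 6 ↔ 4 := DiffMod.fminus_eq_bot_iff hb hr M
  tfae_have 5 ↔ 4 := by
    rw [DiffMod.homIncl_bijective_iff_growthLE hb hr M hr0,
      ← DiffMod.growth_le_iff_growthLE hb hc hsp e, ENNReal.ofReal_div_of_pos hr0,
      ENNReal.le_div_iff_mul_le (Or.inr (by simpa using hω)) (Or.inr ENNReal.ofReal_ne_top),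
      ENNReal.le_div_iff_mul_le (Or.inl (by simpa using hr0)) (Or.inl ENNReal.ofReal_ne_top),
      mul_comm]
  tfae_have 3 ↔ 4 := by
    rw [DiffMod.homIncl_bijective_iff_growthLE hb hr M hr0, DiffMod.multSupp_subset_iff M hr0 hr]
    constructor
    · intro h τ hτ
      obtain ⟨A, -, hA⟩ :=
        DiffMod.exists_norm_iterate_le_uniform hb (hc.trans hτ) (hsp.trans_lt hτ)
      exact (DiffMod.growthLE_iff_factor M (hc.trans hτ) hA).mpr fun i =>
        (DiffMod.spNorm_le_iff_growthLE _ hb hc hsp).mp (h i) τ hτ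
    · intro h i
      refine (DiffMod.spNorm_le_iff_growthLE _ hb hc hsp).mpr fun τ hτ => ?_
      obtain ⟨A, -, hA⟩ :=
        DiffMod.exists_norm_iterate_le_uniform hb (hc.trans hτ) (hsp.trans_lt hτ)
      exact (DiffMod.growthLE_iff_factor M (hc.trans hτ) hA).mp (h τ hτ) i
  tfae_finish
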